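/- **Theorem (ergodic rate of zero-forcing reception over correlated fading).** Let $K\ge 1$ be a fixed number of users, $k\in\{1,\dots,K\}$, let $\mathcal P_s,\sigma,\varrho,\beta_1,\dots,\beta_K>0$ and let $\varphi,\theta,\vartheta,d,\lambda_0$ be real with $\lambda_0\neq0$. For each number $M$ of receiver sensors consider the signal model $\boldsymbol v=\boldsymbol\Theta\boldsymbol H\boldsymbol s+\boldsymbol w$ (transmit power $\mathcal P_s$ per user, complex white Gaussian noise of variance $\sigma^2$), where $$\boldsymbol\Theta=\sqrt{\varrho}\,\Phi\,\mathrm{diag}\{1,e^{-j\frac{2\pi}{\lambda_0}d\sin\vartheta},\dots,e^{-j\frac{2\pi}{\lambda_0}(M-1)d\sin\vartheta}\},\qquad \Phi=\tfrac12e^{-j(\theta-\varphi)}+\tfrac12e^{-j(\theta+\varphi)},$$ and the channel is the correlated fading channel $$\boldsymbol H=\boldsymbol U(\boldsymbol\Sigma\odot\boldsymbol G)\boldsymbol D^{1/2},\qquad \boldsymbol\Sigma=\boldsymbol\lambda^{1/2}\boldsymbol 1_K^T,\qquad \boldsymbol D=\mathrm{diag}\{\beta_1,\dots,\beta_K\}.$$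 Here $\boldsymbol G\in\mathbb C^{M\times K}$ has i.i.d. $\mathcal{CN}(0,1)$ entries, and $\boldsymbol R=\boldsymbol U\,\mathrm{diag}\{\boldsymbol\lambda\}\,\boldsymbol U^*$, with $\boldsymbol U$ unitary, is any eigendecomposition of the receiver-side correlation matrix $\boldsymbol R=\boldsymbol R_M\in\mathbb C^{M\times M}$. Assume that either $\boldsymbol R_M$ is given by Jakes' model, $[\boldsymbol R_M]_{m_1m_2}=J_0(\varpi|m_1-m_2|)$ for all $M$ with a fixed $\varpi>0$ ($J_0$ the Bessel function of the first kind of order zero), or, more generally, that every $\boldsymbol R_M$ is positive semidefinite with $\mathrm{Tr}\,\boldsymbol R_M=M$ and $\mathrm{Tr}(\boldsymbol R_M^2)/M^2\to0$ as $M\to\infty$. Let $\boldsymbol C=\boldsymbol\Theta\boldsymbol H(\boldsymbol H^*\boldsymbol\Theta^*\boldsymbol\Theta\boldsymbol H)^{-1}$ be the zero-forcing combiner, with columns $\boldsymbol c_i$, let $\boldsymbol h_i$ be the columns of $\boldsymbol H$, and put $$\gamma_k=\frac{\mathcal P_s|\boldsymbol c_k^*\boldsymbol\Theta\boldsymbol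 h_k|^2}{\mathcal P_s\sum_{i\ne k}|\boldsymbol c_k^*\boldsymbol\Theta\boldsymbol h_i|^2+\sigma^2\|\boldsymbol c_k\|^2},\qquad R_k=\mathbb E\{\log_2(1+\gamma_k)\},\qquad \mathsf{SNR}_{1,k}=\frac{\varrho\,\mathcal P_s}{\sigma^2}\beta_k,$$ with the convention $\gamma_k=0$ when the matrix to be inverted is singular. Then the expectation $R_k$ is finite for every $M$, and, as $M\to\infty$ with everything else fixed, $$R_k\sim R_k^{(\mathrm{zf,cfc})}:=\log_2\!\big[1+(M-2K-2)\,\mathsf{SNR}_{1,k}\cos^2\varphi\big],$$ both in the sense of asymptotic equivalence (the ratio $R_k/R_k^{(\mathrm{zf,cfc})}$ tends to $1$; if $\cos\varphi=0$ both sides vanish) and in the stronger sense that $R_k-R_k^{(\mathrm{zf,cfc})}\to0$. -/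

import Mathlib

open Filter Topology MeasureTheory ProbabilityTheory Asymptotics
open scoped Matrix ComplexOrder

noncomputable section

/-- The standard circularly symmetric complex Gaussian law `CN(0,1)`: independent real and
imaginary parts, each with law `N(0, 1/2)`. -/
def stdComplexGaussian : Measure ℂ :=
  ((gaussianReal 0 (1 / 2)).prod (gaussianReal 0 (1 / 2))).map (fun p => (⟨p.1, p.2⟩ : ℂ))

/-- The Bessel function of the first kind of order zero (Bessel's integral). -/
def besselJ0 (x : ℝ) : ℝ :=
  (1 / Real.pi) * ∫ t in (0 : ℝ)..Real.pi, Real.cos (x * Real.sin t)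

/-- Jakes' correlation matrix, with entries `J₀(ϖ |m₁ - m₂|)`. -/
def jakesMatrix (ϖ : ℝ) (M : ℕ) : Matrix (Fin M) (Fin M) ℂ :=
  Matrix.of fun m₁ m₂ => ((besselJ0 (ϖ * |((m₁ : ℕ) : ℝ) - ((m₂ : ℕ) : ℝ)|) : ℝ) : ℂ)

/-- The common phase factor `Φ = (e^{-j(θ-φ)} + e^{-j(θ+φ)}) / 2`, where `θ` is the phase of the
local oscillator at the reference sensor. -/
def phaseShift (θ φ : ℝ) : ℂ :=
  Complex.exp (-(Complex.I * ((θ - φ : ℝ) : ℂ))) / 2 +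
    Complex.exp (-(Complex.I * ((θ + φ : ℝ) : ℂ))) / 2

/-- The diagonal steering matrix
`Q = diag (1, e^{-j (2π/w) d sin ϑ}, …, e^{-j (2π/w) (M-1) d sin ϑ})` for wavelength `w`. -/
def steeringMatrix (w d ϑ : ℝ) (M : ℕ) : Matrix (Fin M) (Fin M) ℂ :=
  Matrix.diagonal fun m =>
    Complex.exp (-(Complex.I * ((2 * Real.pi / w * ((m : ℕ) : ℝ) * d * Real.sin ϑ : ℝ) : ℂ)))

/-- The receiver response matrix `Θ = √ρ Φ Q`. -/
def responseMatrix (ρ θ φ w d ϑ : ℝ) (M : ℕ) : Matrix (Fin M) (Fin M) ℂ :=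
  (((Real.sqrt ρ : ℝ) : ℂ) * phaseShift θ φ) • steeringMatrix w d ϑ M

/-- The correlated fading channel `H = U (Σ ⊙ G) D^{1/2}`, where `Σ = λ^{1/2} 1ᵀ` and
`D = diag β`. -/
def cfcChannel {M K : ℕ} (U : Matrix (Fin M) (Fin M) ℂ) (lam : Fin M → ℝ) (β : Fin K → ℝ)
    (G : Matrix (Fin M) (Fin K) ℂ) : Matrix (Fin M) (Fin K) ℂ :=
  U * (Matrix.hadamard
      (Matrix.vecMulVec (fun m => ((Real.sqrt (lam m) : ℝ) : ℂ)) (fun _ : Fin K => (1 : ℂ))) G) *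
    Matrix.diagonal (fun i => ((Real.sqrt (β i) : ℝ) : ℂ))

/-- The zero-forcing combiner `C = Θ H (H* Θ* Θ H)⁻¹`. -/
def zfCombiner {M K : ℕ} (Θ : Matrix (Fin M) (Fin M) ℂ) (H : Matrix (Fin M) (Fin K) ℂ) :
    Matrix (Fin M) (Fin K) ℂ :=
  Θ * H * (Hᴴ * Θᴴ * Θ * H)⁻¹

/-- The SINR of user `k` for a combiner `C` with columns `c_k` and a channel `H` with columns
`h_i`:  `P |c_k* Θ h_k|² / (P ∑_{i ≠ k} |c_k* Θ h_i|² + σ² ‖c_k‖²)`. -/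
def sinr {M K : ℕ} (P σ : ℝ) (Θ : Matrix (Fin M) (Fin M) ℂ) (H C : Matrix (Fin M) (Fin K) ℂ)
    (k : Fin K) : ℝ :=
  (P * ‖(Cᴴ * Θ * H) k k‖ ^ 2) /
    (P * ∑ i ∈ Finset.univ.erase k, ‖(Cᴴ * Θ * H) k i‖ ^ 2 + σ ^ 2 * ∑ m, ‖C m k‖ ^ 2)

/-- The instantaneous rate `log₂ (1 + γ_k)` of user `k` with zero-forcing combining. -/
def zfRate {M K : ℕ} (P σ : ℝ) (Θ : Matrix (Fin M) (Fin M) ℂ) (H : Matrix (Fin M) (Fin K) ℂ)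
    (k : Fin K) : ℝ :=
  Real.logb 2 (1 + sinr P σ Θ H (zfCombiner Θ H) k)

/-- The per-sensor signal-to-noise ratio `SNR_{1,k} = ρ P β_k / σ²`. -/
def snrOne (ρ P σ βk : ℝ) : ℝ := ρ * P / σ ^ 2 * βk

end

/-! Write s = SNR_{1,k} cos²φ, Λ = diag λ, W = Gᴴ Λ G and a = [W⁻¹]ₖₖ. Since Θᴴ Θ is scalar and U is
unitary, zero forcing gives γₖ = s / a (`zfRate_eq`): the phases and U disappear. The expectation of
log (1 + s / a) is then squeezed between two bounds that both equal log (s M) + o(1). The constant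
2K + 2 therefore carries no weight; any fixed shift of M has the same limit.

Upper bound: 1 / a ≤ Wₖₖ, the mean of Wₖₖ is Tr R = M, and concavity of the logarithm gives log (1 +
s M).

Lower bound: log (1 + s / a) ≥ log (s M) - log (M a) ≥ log (s M) + 1 - M a, so it suffices that E a
≤ 1 / (M - K ℓ), where ℓ = o(M) dominates every eigenvalue. Here 1 / a is the squared distance from
column k of Λ^{1/2} G to the span of the others. Given those, it is ‖T g‖² with g Gaussian and T the
operator Λ^{1/2} followed by an orthogonal projection; T* T has eigenvalues at most ℓ and trace at
least M - (K - 1) ℓ, and `lintegral_inv_sq_norm_le` bounds the negative moment.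

Finally ∑ λ² = Tr R² = o(M²) supplies ℓ. For Jakes' model, J₀ tends to 0 at infinity by
Riemann–Lebesgue, and a Cesàro average bounds Tr R². -/

/-! ### Complex Gaussian vectors: unitary invariance and Laplace transform. -/

section StdComplexGaussian

lemma measurable_complex_mk : Measurable (fun p : ℝ × ℝ => (⟨p.1, p.2⟩ : ℂ)) :=
  Complex.measurableEquivRealProd.symm.measurable

instance isProbabilityMeasure_stdComplexGaussian : IsProbabilityMeasure stdComplexGaussian :=
  Measure.isProbabilityMeasure_map measurable_complex_mk.aemeasurable

/-- The real and imaginary parts have variance 1/2, whence the 4. The value depends on ‖t‖ alone,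
which is the source of unitary invariance. -/
lemma charFun_stdComplexGaussian (t : ℂ) :
    charFun stdComplexGaussian t = Complex.exp (-((‖t‖ ^ 2 : ℝ) : ℂ) / 4) := by
  have key : ∀ p : ℝ × ℝ, Complex.exp ((inner ℝ (⟨p.1, p.2⟩ : ℂ) t : ℝ) * Complex.I) =
      Complex.exp (t.re * p.1 * Complex.I) * Complex.exp (t.im * p.2 * Complex.I) := by
    intro p
    rw [← Complex.exp_add]
    congr 1
    simp [Complex.inner]
    ring
  rw [charFun_apply, stdComplexGaussian,
    integral_map measurable_complex_mk.aemeasurable (by fun_prop)]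
  simp_rw [key]
  rw [integral_prod_mul (fun x : ℝ => Complex.exp (t.re * x * Complex.I))
      (fun x : ℝ => Complex.exp (t.im * x * Complex.I)), ← charFun_apply_real,
    ← charFun_apply_real, charFun_gaussianReal, charFun_gaussianReal, ← Complex.exp_add]
  congr 1
  rw [← Complex.normSq_eq_norm_sq, Complex.normSq_apply]
  push_cast
  simp
  ring

lemma integral_exp_neg_mul_sq_gaussianReal {c : ℝ} (hc : 0 ≤ c) :
    ∫ x, Real.exp (-(c * x ^ 2)) ∂(gaussianReal 0 (1 / 2)) = √(1 / (1 + c)) := by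
  rw [integral_gaussianReal_eq_integral_smul (by norm_num)]
  have : ∀ x : ℝ, gaussianPDFReal 0 (1 / 2) x • Real.exp (-(c * x ^ 2)) =
      (√Real.pi)⁻¹ * Real.exp (-(1 + c) * x ^ 2) := by
    intro x
    simp only [gaussianPDFReal, smul_eq_mul]
    rw [mul_assoc, ← Real.exp_add]
    congr 1
    · congr 2
      push_cast
      ring
    · congr 1
      push_cast
      ring
  simp_rw [this]
  rw [integral_const_mul, integral_gaussian, Real.sqrt_div Real.pi_pos.le,
    Real.sqrt_div zero_le_one, Real.sqrt_one]
  have : √Real.pi ≠ 0 := (Real.sqrt_pos.2 Real.pi_pos).ne'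
  field_simp

lemma integral_exp_neg_mul_sq_stdComplexGaussian {c : ℝ} (hc : 0 ≤ c) :
    ∫ z, Real.exp (-(c * ‖z‖ ^ 2)) ∂stdComplexGaussian = 1 / (1 + c) := by
  rw [stdComplexGaussian, integral_map measurable_complex_mk.aemeasurable (by fun_prop)]
  have : ∀ p : ℝ × ℝ, Real.exp (-(c * ‖(⟨p.1, p.2⟩ : ℂ)‖ ^ 2)) =
      Real.exp (-(c * p.1 ^ 2)) * Real.exp (-(c * p.2 ^ 2)) := by
    intro p
    rw [← Real.exp_add, ← Complex.normSq_eq_norm_sq, Complex.normSq_apply]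
    ring_nf
  simp_rw [this]
  rw [integral_prod_mul (fun x : ℝ => Real.exp (-(c * x ^ 2)))
      (fun x : ℝ => Real.exp (-(c * x ^ 2))), integral_exp_neg_mul_sq_gaussianReal hc,
    Real.mul_self_sqrt (by positivity)]

lemma integrable_sq_gaussianReal (v : NNReal) : Integrable (fun x : ℝ => x ^ 2) (gaussianReal 0 v) :=
  (memLp_id_gaussianReal 2).integrable_sq

lemma integral_sq_gaussianReal (v : NNReal) : ∫ x, x ^ 2 ∂(gaussianReal 0 v) = v := by
  have h := variance_id_gaussianReal (μ := 0) (v := v)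
  rw [variance_eq_integral (by fun_prop)] at h
  simpa using h

lemma integrable_sq_norm_stdComplexGaussian :
    Integrable (fun z : ℂ => ‖z‖ ^ 2) stdComplexGaussian := by
  rw [stdComplexGaussian, integrable_map_measure (by fun_prop) measurable_complex_mk.aemeasurable]
  have : (fun z : ℂ => ‖z‖ ^ 2) ∘ (fun p : ℝ × ℝ => (⟨p.1, p.2⟩ : ℂ)) =
      fun p => p.1 ^ 2 + p.2 ^ 2 := by
    ext p
    simp only [Function.comp]
    rw [← Complex.normSq_eq_norm_sq, Complex.normSq_apply]
    ring
  rw [this]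
  exact ((integrable_sq_gaussianReal _).comp_fst _).add ((integrable_sq_gaussianReal _).comp_snd _)

lemma integral_sq_norm_stdComplexGaussian : ∫ z, ‖z‖ ^ 2 ∂stdComplexGaussian = 1 := by
  rw [stdComplexGaussian, integral_map measurable_complex_mk.aemeasurable (by fun_prop)]
  have : ∀ p : ℝ × ℝ, ‖(⟨p.1, p.2⟩ : ℂ)‖ ^ 2 = p.1 ^ 2 + p.2 ^ 2 := by
    intro p
    rw [← Complex.normSq_eq_norm_sq, Complex.normSq_apply]
    ring
  simp_rw [this]
  rw [integral_add ((integrable_sq_gaussianReal _).comp_fst _)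
    ((integrable_sq_gaussianReal _).comp_snd _), integral_fun_fst (f := fun x : ℝ => x ^ 2),
    integral_fun_snd (f := fun x : ℝ => x ^ 2), integral_sq_gaussianReal]
  norm_num

variable {ι : Type*} [Fintype ι]

/-- The law of a vector of i.i.d. `CN(0,1)` entries, on the Euclidean space `ℂ^ι`. -/
noncomputable def stdComplexGaussianVec (ι : Type*) [Fintype ι] : Measure (EuclideanSpace ℂ ι) :=
  (Measure.pi fun _ : ι => stdComplexGaussian).map (WithLp.toLp 2)

instance isProbabilityMeasure_stdComplexGaussianVec :
    IsProbabilityMeasure (stdComplexGaussianVec ι) :=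
  Measure.isProbabilityMeasure_map (by fun_prop)

lemma charFun_stdComplexGaussianVec (t : EuclideanSpace ℂ ι) :
    charFun (stdComplexGaussianVec ι) t = Complex.exp (-((‖t‖ ^ 2 : ℝ) : ℂ) / 4) := by
  rw [stdComplexGaussianVec, charFun_pi]
  simp_rw [charFun_stdComplexGaussian]
  rw [← Complex.exp_sum, EuclideanSpace.norm_sq_eq]
  congr 1
  push_cast
  rw [← Finset.sum_div, Finset.sum_neg_distrib]

/-- Unitary invariance of the complex Gaussian vector. -/
lemma map_stdComplexGaussianVec (e : EuclideanSpace ℂ ι ≃ₗᵢ[ℂ] EuclideanSpace ℂ ι) :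
    (stdComplexGaussianVec ι).map e = stdComplexGaussianVec ι := by
  have : IsProbabilityMeasure ((stdComplexGaussianVec ι).map e) :=
    Measure.isProbabilityMeasure_map e.continuous.measurable.aemeasurable
  refine Measure.ext_of_charFun (E := EuclideanSpace ℂ ι) ?_
  ext t
  have h : charFun ((stdComplexGaussianVec ι).map e) t =
      charFun (stdComplexGaussianVec ι) (e.symm t) := by
    rw [charFun_apply, charFun_apply, integral_map e.continuous.measurable.aemeasurable
      (by fun_prop)]
    congr 1
    ext x
    congr 3
    -- Characteristic functions pair through the real inner product; polarization expresses it by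
    -- norms, which the complex isometry preserves.
    have hx : e x + t = e (x + e.symm t) := by simp
    rw [real_inner_eq_norm_add_mul_self_sub_norm_mul_self_sub_norm_mul_self_div_two,
      real_inner_eq_norm_add_mul_self_sub_norm_mul_self_sub_norm_mul_self_div_two, hx,
      e.norm_map, e.norm_map, e.symm.norm_map]
  rw [h, charFun_stdComplexGaussianVec, charFun_stdComplexGaussianVec, e.symm.norm_map]

/-- By unitary invariance the coordinates in any orthonormal basis are again i.i.d., so the integral
factors over the basis. -/
lemma integral_exp_neg_sum_stdComplexGaussianVec (v : OrthonormalBasis ι ℂ (EuclideanSpace ℂ ι))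
    {c : ι → ℝ} (hc : ∀ i, 0 ≤ c i) :
    ∫ x, Real.exp (-∑ i, c i * ‖v.repr x i‖ ^ 2) ∂(stdComplexGaussianVec ι) =
      ∏ i, 1 / (1 + c i) := by
  rw [← integral_map (μ := stdComplexGaussianVec ι) (φ := v.repr)
    (f := fun y : EuclideanSpace ℂ ι => Real.exp (-∑ i, c i * ‖y i‖ ^ 2))
    v.repr.continuous.measurable.aemeasurable (by fun_prop), map_stdComplexGaussianVec,
    stdComplexGaussianVec, integral_map (by fun_prop) (by fun_prop)]
  simp_rw [← Finset.sum_neg_distrib, Real.exp_sum]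
  rw [integral_fintype_prod_eq_prod (fun i (z : ℂ) => Real.exp (-(c i * ‖z‖ ^ 2)))]
  exact Finset.prod_congr rfl fun i _ => integral_exp_neg_mul_sq_stdComplexGaussian (hc i)

end StdComplexGaussian

/-! ### First negative moment of a Gaussian quadratic form. -/

section NegativeMoment

/-- `1 / x = ∫₀^∞ e^{-u x} du`, valid in `[0, ∞]` for every `x ≥ 0`. -/
lemma inv_ofReal_eq_lintegral_exp {x : ℝ} (hx : 0 ≤ x) :
    (ENNReal.ofReal x)⁻¹ = ∫⁻ u in Set.Ioi (0 : ℝ), ENNReal.ofReal (Real.exp (-(u * x))) := by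
  rcases hx.eq_or_lt with rfl | hx
  -- At x = 0 both sides are ∞.
  · simp
  · have hint : IntegrableOn (fun u : ℝ => Real.exp (-(u * x))) (Set.Ioi 0) := by
      have := integrableOn_exp_mul_Ioi (a := -x) (by linarith) 0
      refine this.congr_fun (fun u _ => ?_) measurableSet_Ioi
      ring_nf
    rw [← ofReal_integral_eq_lintegral_ofReal hint (ae_of_all _ fun _ => (Real.exp_pos _).le),
      ← ENNReal.ofReal_inv_of_pos hx]
    congr 1
    have := integral_exp_mul_Ioi (a := -x) (by linarith) 0
    simp only [mul_zero, Real.exp_zero] at this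
    have h2 : ∀ u : ℝ, Real.exp (-(u * x)) = Real.exp (-x * u) := fun u => by ring_nf
    simp_rw [h2]
    rw [this]
    field_simp

lemma lintegral_Ioi_one_add_mul_rpow {ℓ q : ℝ} (hℓ : 0 < ℓ) (hq : 1 < q) :
    ∫⁻ u in Set.Ioi (0 : ℝ), ENNReal.ofReal ((1 + u * ℓ) ^ (-q)) =
      ENNReal.ofReal (1 / (ℓ * (q - 1))) := by
  have hpos : ∀ u ∈ Set.Ici (0 : ℝ), 0 < 1 + u * ℓ := fun u hu => by
    have : 0 ≤ u * ℓ := mul_nonneg hu hℓ.le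
    linarith
  have hder : ∀ u ∈ Set.Ici (0 : ℝ),
      HasDerivAt (fun u : ℝ => (1 + u * ℓ) ^ (1 - q) / (ℓ * (1 - q))) ((1 + u * ℓ) ^ (-q)) u := by
    intro u hu
    have h1 : HasDerivAt (fun u : ℝ => 1 + u * ℓ) ℓ u := by
      simpa using ((hasDerivAt_id u).mul_const ℓ).const_add 1
    have h2 := (h1.rpow_const (p := 1 - q) (Or.inl (hpos u hu).ne')).div_const (ℓ * (1 - q))
    refine h2.congr_deriv ?_
    have : 1 - q ≠ 0 := by linarith
    rw [show 1 - q - 1 = -q by ring]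
    field_simp
  have hlim : Tendsto (fun u : ℝ => (1 + u * ℓ) ^ (1 - q) / (ℓ * (1 - q))) atTop (𝓝 0) := by
    have h1 : Tendsto (fun u : ℝ => 1 + u * ℓ) atTop atTop :=
      tendsto_atTop_add_const_left _ _ (tendsto_id.atTop_mul_const hℓ)
    have h2 := (tendsto_rpow_neg_atTop (y := q - 1) (by linarith)).comp h1
    have h3 := h2.div_const (ℓ * (1 - q))
    simpa [Function.comp_def] using h3
  have hnn : ∀ u ∈ Set.Ioi (0 : ℝ), 0 ≤ (1 + u * ℓ) ^ (-q) := fun u hu =>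
    Real.rpow_nonneg (hpos u (Set.mem_Ici.2 (le_of_lt hu))).le _
  have hint := integrableOn_Ioi_deriv_of_nonneg' hder hnn hlim
  rw [← ofReal_integral_eq_lintegral_ofReal hint
    ((ae_restrict_iff' measurableSet_Ioi).2 (ae_of_all _ hnn)),
    integral_Ioi_of_hasDerivAt_of_nonneg' hder hnn hlim]
  congr 1
  have : 1 - q ≠ 0 := by linarith
  have : q - 1 ≠ 0 := by linarith
  simp only [zero_mul, add_zero, Real.one_rpow]
  field_simp
  ring

/-- Concavity of the logarithm: a product of factors `1 + u bᵢ` with `0 ≤ bᵢ ≤ ℓ` is smallest when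
all the nonzero `bᵢ` equal `ℓ`. -/
lemma one_add_mul_rpow_le_prod {ι : Type*} [Fintype ι] {b : ι → ℝ} {ℓ u : ℝ} (hℓ : 0 < ℓ)
    (hu : 0 ≤ u) (hb0 : ∀ i, 0 ≤ b i) (hb : ∀ i, b i ≤ ℓ) :
    (1 + u * ℓ) ^ ((∑ i, b i) / ℓ) ≤ ∏ i, (1 + u * b i) := by
  have h1 : 0 ≤ u * ℓ := mul_nonneg hu hℓ.le
  rw [Finset.sum_div, Real.rpow_sum_of_pos (by linarith)]
  refine Finset.prod_le_prod (fun i _ => Real.rpow_nonneg (by linarith) _) fun i _ => ?_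
  -- Bernoulli's inequality with exponent bᵢ / ℓ in [0, 1].
  have := rpow_one_add_le_one_add_mul_self (s := u * ℓ) (by linarith)
    (div_nonneg (hb0 i) hℓ.le) ((div_le_one hℓ).2 (hb i))
  refine this.trans_eq ?_
  field_simp

variable {ι : Type*} [Fintype ι]

/-- Writing 1 / x as ∫ e^{-ux} du turns the moment into an integral over u of ∏ 1 / (1 + u bᵢ). This
product is at most (1 + u ℓ)^{-q} with q = ∑ bᵢ / ℓ, which is integrable exactly when q > 1, that
is, under `hsum`. -/
lemma lintegral_inv_sum_stdComplexGaussianVec_le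
    (v : OrthonormalBasis ι ℂ (EuclideanSpace ℂ ι)) {b : ι → ℝ} {ℓ : ℝ} (hℓ : 0 < ℓ)
    (hb0 : ∀ i, 0 ≤ b i) (hb : ∀ i, b i ≤ ℓ) (hsum : ℓ < ∑ i, b i) :
    ∫⁻ x, (ENNReal.ofReal (∑ i, b i * ‖v.repr x i‖ ^ 2))⁻¹ ∂(stdComplexGaussianVec ι) ≤
      ENNReal.ofReal (1 / (∑ i, b i - ℓ)) := by
  have hnn : ∀ x, 0 ≤ ∑ i, b i * ‖v.repr x i‖ ^ 2 := fun x =>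
    Finset.sum_nonneg fun i _ => mul_nonneg (hb0 i) (sq_nonneg _)
  simp_rw [fun x => inv_ofReal_eq_lintegral_exp (hnn x)]
  rw [lintegral_lintegral_swap (by
    apply Measurable.aemeasurable
    apply ENNReal.measurable_ofReal.comp
    apply Continuous.measurable
    fun_prop)]
  have hq : 1 < (∑ i, b i) / ℓ := (one_lt_div hℓ).2 hsum
  have hval : 1 / (∑ i, b i - ℓ) = 1 / (ℓ * ((∑ i, b i) / ℓ - 1)) := by
    congr 1
    field_simp
  rw [hval, ← lintegral_Ioi_one_add_mul_rpow hℓ hq]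
  refine setLIntegral_mono' measurableSet_Ioi fun u hu => ?_
  have hu0 : 0 ≤ u := le_of_lt hu
  have hexp : ∀ x : EuclideanSpace ℂ ι, Real.exp (-(u * ∑ i, b i * ‖v.repr x i‖ ^ 2)) =
      Real.exp (-∑ i, (u * b i) * ‖v.repr x i‖ ^ 2) := fun x => by
    simp_rw [Finset.mul_sum, mul_assoc]
  simp_rw [hexp]
  rw [← ofReal_integral_eq_lintegral_ofReal _ (ae_of_all _ fun _ => (Real.exp_pos _).le),
    integral_exp_neg_sum_stdComplexGaussianVec v fun i => mul_nonneg hu0 (hb0 i)]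
  · refine ENNReal.ofReal_le_ofReal ?_
    rw [Real.rpow_neg (by positivity)]
    simp_rw [one_div]
    rw [Finset.prod_inv_distrib]
    have : 0 < 1 + u * ℓ := by positivity
    exact inv_anti₀ (Real.rpow_pos_of_pos this _) (one_add_mul_rpow_le_prod hℓ hu0 hb0 hb)
  · refine Integrable.of_bound (C := 1) (by fun_prop) (ae_of_all _ fun x => ?_)
    rw [Real.norm_eq_abs, abs_of_pos (Real.exp_pos _), Real.exp_le_one_iff, neg_nonpos]
    exact Finset.sum_nonneg fun i _ => mul_nonneg (mul_nonneg hu0 (hb0 i)) (sq_nonneg _)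

/-- Bound on the first negative moment of `‖T g‖²` for a standard complex Gaussian vector `g`. -/
lemma lintegral_inv_sq_norm_le {F : Type*} [NormedAddCommGroup F] [InnerProductSpace ℂ F]
    [FiniteDimensional ℂ F] (T : EuclideanSpace ℂ ι →ₗ[ℂ] F) {ℓ t : ℝ} (hℓ : 0 < ℓ)
    (hT : ∀ x, ‖T x‖ ^ 2 ≤ ℓ * ‖x‖ ^ 2)
    (ht : ∀ v : OrthonormalBasis ι ℂ (EuclideanSpace ℂ ι), t ≤ ∑ i, ‖T (v i)‖ ^ 2) (hlt : ℓ < t) :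
    ∫⁻ x, (ENNReal.ofReal (‖T x‖ ^ 2))⁻¹ ∂(stdComplexGaussianVec ι) ≤
      ENNReal.ofReal (1 / (t - ℓ)) := by
  have hpos := T.isPositive_adjoint_comp_self
  have hsym := hpos.isSymmetric
  have hn : Module.finrank ℂ (EuclideanSpace ℂ ι) = Fintype.card ι := finrank_euclideanSpace
  -- In an eigenbasis of T* T the form ‖T x‖² is diagonal, with coefficients bᵢ = ‖T vᵢ‖².
  let v := (hsym.eigenvectorBasis hn).reindex (Fintype.equivFin ι).symm
  let b : ι → ℝ := fun i => hsym.eigenvalues hn (Fintype.equivFin ι i)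
  have hv : ∀ i, (LinearMap.adjoint T ∘ₗ T) (v i) = (b i : ℂ) • v i := fun i => by
    simp only [v, b, OrthonormalBasis.reindex_apply, Equiv.symm_symm]
    exact hsym.apply_eigenvectorBasis hn _
  have hinner : ∀ x i, inner ℂ (T x) (T (v i)) = b i * inner ℂ x (v i) := fun x i => by
    have := hv i
    rw [LinearMap.comp_apply] at this
    rw [← LinearMap.adjoint_inner_right, this, inner_smul_right]
  have hbv : ∀ i, b i = ‖T (v i)‖ ^ 2 := fun i => by
    have h := hinner (v i) i
    rw [inner_self_eq_norm_sq_to_K, inner_self_eq_norm_sq_to_K, v.norm_eq_one] at h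
    simp only [map_one, one_pow, mul_one] at h
    exact Complex.ofReal_injective (by simpa using h.symm)
  have hquad : ∀ x, ‖T x‖ ^ 2 = ∑ i, b i * ‖v.repr x i‖ ^ 2 := fun x => by
    have h1 : inner ℂ (T x) (T x) = ∑ i, v.repr x i * (b i * inner ℂ x (v i)) := by
      conv_lhs =>
        arg 3
        rw [← v.sum_repr x, map_sum]
      rw [inner_sum]
      refine Finset.sum_congr rfl fun i _ => ?_
      rw [map_smul, inner_smul_right, hinner]
    have h2 : ∀ i, v.repr x i * (b i * inner ℂ x (v i)) = ((b i * ‖v.repr x i‖ ^ 2 : ℝ) : ℂ) := by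
      intro i
      rw [v.repr_apply_apply, ← inner_conj_symm x (v i)]
      push_cast
      rw [← Complex.mul_conj']
      ring
    simp_rw [h2] at h1
    rw [inner_self_eq_norm_sq_to_K] at h1
    exact Complex.ofReal_injective (by simpa using h1)
  simp_rw [hquad]
  have hsum := ht v
  simp_rw [← hbv] at hsum
  refine (lintegral_inv_sum_stdComplexGaussianVec_le v hℓ (fun i => ?_) (fun i => ?_)
    (hlt.trans_le hsum)).trans (ENNReal.ofReal_le_ofReal ?_)
  · rw [hbv]; positivity
  · rw [hbv]
    simpa using hT (v i)
  · exact one_div_le_one_div_of_le (by linarith) (by linarith)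

end NegativeMoment

/-! ### Distance from one column to the span of the others. -/

section Columns

variable {ι κ : Type*} [Fintype ι] [Fintype κ]

/-- The square root of the diagonal operator with eigenvalues `lam`. -/
noncomputable def diagSqrt (lam : ι → ℝ) : EuclideanSpace ℂ ι →ₗ[ℂ] EuclideanSpace ℂ ι where
  toFun x := WithLp.toLp 2 fun m => ((√(lam m) : ℝ) : ℂ) * x m
  map_add' x y := by ext m; simp [mul_add]
  map_smul' c x := by ext m; simp [mul_left_comm]

omit [Fintype ι] in
@[simp] lemma diagSqrt_apply (lam : ι → ℝ) (x : EuclideanSpace ℂ ι) (m : ι) :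
    diagSqrt lam x m = ((√(lam m) : ℝ) : ℂ) * x m := rfl

lemma norm_diagSqrt_sq {lam : ι → ℝ} (h0 : ∀ m, 0 ≤ lam m) (x : EuclideanSpace ℂ ι) :
    ‖diagSqrt lam x‖ ^ 2 = ∑ m, lam m * ‖x m‖ ^ 2 := by
  rw [EuclideanSpace.norm_sq_eq]
  refine Finset.sum_congr rfl fun m _ => ?_
  rw [diagSqrt_apply, norm_mul, mul_pow, Complex.norm_real, Real.norm_eq_abs, sq_abs,
    Real.sq_sqrt (h0 m)]

lemma norm_diagSqrt_sq_le {lam : ι → ℝ} {ℓ : ℝ} (h0 : ∀ m, 0 ≤ lam m) (hℓ : ∀ m, lam m ≤ ℓ)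
    (x : EuclideanSpace ℂ ι) : ‖diagSqrt lam x‖ ^ 2 ≤ ℓ * ‖x‖ ^ 2 := by
  rw [norm_diagSqrt_sq h0, EuclideanSpace.norm_sq_eq, Finset.mul_sum]
  exact Finset.sum_le_sum fun m _ => mul_le_mul_of_nonneg_right (hℓ m) (sq_nonneg _)

lemma inner_diagSqrt (lam : ι → ℝ) (x y : EuclideanSpace ℂ ι) :
    inner ℂ x (diagSqrt lam y) = inner ℂ (diagSqrt lam x) y := by
  simp only [PiLp.inner_apply, diagSqrt_apply, RCLike.inner_apply, map_mul, Complex.conj_ofReal]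
  exact Finset.sum_congr rfl fun m _ => by ring

lemma sum_norm_diagSqrt_sq {lam : ι → ℝ} (h0 : ∀ m, 0 ≤ lam m)
    (v : OrthonormalBasis ι ℂ (EuclideanSpace ℂ ι)) :
    ∑ i, ‖diagSqrt lam (v i)‖ ^ 2 = ∑ m, lam m := by
  classical
  simp_rw [norm_diagSqrt_sq h0]
  rw [Finset.sum_comm]
  refine Finset.sum_congr rfl fun m _ => ?_
  have h := v.sum_sq_norm_inner_left (EuclideanSpace.single m (1 : ℂ))
  simp only [EuclideanSpace.inner_single_left, PiLp.norm_single] at h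
  rw [← Finset.mul_sum]
  simp at h
  rw [h, mul_one]

/-- The sum is the trace of Λ^{1/2} P_S Λ^{1/2}; each vector of an orthonormal basis of S
contributes at most ℓ. Hence projecting S away costs at most ℓ per dimension. -/
lemma sum_norm_starProjection_diagSqrt_sq_le {lam : ι → ℝ} {ℓ : ℝ} (h0 : ∀ m, 0 ≤ lam m)
    (hℓ : ∀ m, lam m ≤ ℓ) (S : Submodule ℂ (EuclideanSpace ℂ ι))
    (v : OrthonormalBasis ι ℂ (EuclideanSpace ℂ ι)) :
    ∑ i, ‖S.starProjection (diagSqrt lam (v i))‖ ^ 2 ≤ Module.finrank ℂ S * ℓ := by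
  let u := stdOrthonormalBasis ℂ S
  have hnorm : ∀ y, ‖S.starProjection y‖ ^ 2 = ∑ j, ‖inner ℂ (u j : EuclideanSpace ℂ ι) y‖ ^ 2 := by
    intro y
    have h := u.sum_sq_norm_inner_right (S.orthogonalProjectionOnto y)
    rw [S.starProjection_apply, Submodule.norm_coe, ← h]
    refine Finset.sum_congr rfl fun j _ => ?_
    rw [Submodule.inner_orthogonalProjectionOnto_eq_of_mem_left]
  simp_rw [hnorm]
  rw [Finset.sum_comm]
  have : ∀ j ∈ (Finset.univ : Finset (Fin (Module.finrank ℂ S))),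
      ∑ i, ‖inner ℂ (u j : EuclideanSpace ℂ ι) (diagSqrt lam (v i))‖ ^ 2 ≤ ℓ := by
    intro j _
    simp_rw [inner_diagSqrt]
    rw [v.sum_sq_norm_inner_left]
    refine (norm_diagSqrt_sq_le h0 hℓ _).trans_eq ?_
    have : ‖(u j : EuclideanSpace ℂ ι)‖ = 1 := u.norm_eq_one j
    rw [this]
    ring
  refine (Finset.sum_le_sum this).trans_eq ?_
  simp

/-- The squared distance from column `k` of `Λ^{1/2} G` to the span of the other columns, where
`g i` is column `i` of `G`. -/
noncomputable def colDistSq (lam : ι → ℝ) (k : κ) (g : κ → ι → ℂ) : ENNReal :=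
  ⨅ c : {c : κ → ℂ // c k = 1}, ENNReal.ofReal (∑ m, lam m * ‖∑ i, c.1 i * g i m‖ ^ 2)

/-- The infimum runs over an uncountable family, but an infimum of continuous functions is upper
semicontinuous. -/
lemma measurable_colDistSq (lam : ι → ℝ) (k : κ) : Measurable (colDistSq lam k) := by
  refine UpperSemicontinuous.measurable (upperSemicontinuous_iInf fun c => ?_)
  exact (ENNReal.continuous_ofReal.comp (by fun_prop)).upperSemicontinuous

/-- With the other columns frozen, their span S has dimension at most K - 1, where K is the number
of columns, and only column k is integrated. -/
lemma lintegral_inv_colDistSq_update_le [DecidableEq κ] {lam : ι → ℝ} {ℓ : ℝ} (h0 : ∀ m, 0 ≤ lam m)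
    (hℓ : ∀ m, lam m ≤ ℓ) (hℓ0 : 0 < ℓ) (hlt : Fintype.card κ * ℓ < ∑ m, lam m) (k : κ)
    (g : κ → ι → ℂ) :
    ∫⁻ y, (colDistSq lam k (Function.update g k y))⁻¹
        ∂(Measure.pi fun _ : ι => stdComplexGaussian) ≤
      ENNReal.ofReal (1 / (∑ m, lam m - Fintype.card κ * ℓ)) := by
  let w : {i : κ // i ≠ k} → EuclideanSpace ℂ ι := fun i => diagSqrt lam (WithLp.toLp 2 (g i))
  let S := Submodule.span ℂ (Set.range w)
  have hcard : (Fintype.card {i : κ // i ≠ k} : ℝ) = Fintype.card κ - 1 := by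
    rw [Fintype.card_subtype_compl, Fintype.card_subtype_eq, Nat.cast_sub (Fintype.card_pos_iff.2 ⟨k⟩)]
    simp
  have hS : (Module.finrank ℂ S : ℝ) ≤ Fintype.card κ - 1 := by
    rw [← hcard]
    exact_mod_cast finrank_range_le_card w
  let T : EuclideanSpace ℂ ι →ₗ[ℂ] EuclideanSpace ℂ ι :=
    (Sᗮ.starProjection : EuclideanSpace ℂ ι →ₗ[ℂ] EuclideanSpace ℂ ι) ∘ₗ diagSqrt lam
  have hpyth : ∀ y, ‖y‖ ^ 2 = ‖S.starProjection y‖ ^ 2 + ‖Sᗮ.starProjection y‖ ^ 2 := fun y =>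
    S.norm_sq_eq_add_norm_sq_projection y
  have hproj : ∀ y, ‖Sᗮ.starProjection y‖ ^ 2 ≤ ‖y‖ ^ 2 := fun y => by
    rw [hpyth y]
    linarith [sq_nonneg ‖S.starProjection y‖]
  -- The projection onto Sᗮ contracts, kills the other columns and keeps column k with coefficient
  -- 1, so it bounds every competitor in the infimum from below.
  have hlow : ∀ y : ι → ℂ, ENNReal.ofReal (‖T (WithLp.toLp 2 y)‖ ^ 2) ≤
      colDistSq lam k (Function.update g k y) := by
    intro y
    refine le_iInf fun c => ENNReal.ofReal_le_ofReal ?_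
    have h1 : ∑ m, lam m * ‖∑ i, c.1 i * Function.update g k y i m‖ ^ 2 =
        ‖diagSqrt lam (∑ i, c.1 i • WithLp.toLp 2 (Function.update g k y i))‖ ^ 2 := by
      rw [norm_diagSqrt_sq h0]
      simp
    rw [h1]
    refine le_of_eq_of_le ?_ (hproj _)
    congr 2
    rw [← Finset.add_sum_erase _ _ (Finset.mem_univ k), map_add, map_add, c.2, one_smul,
      Function.update_self, map_sum, map_sum, Finset.sum_eq_zero, add_zero]
    · rfl
    · intro i hi
      have hik : i ≠ k := Finset.ne_of_mem_erase hi
      rw [Function.update_of_ne hik, map_smul, map_smul]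
      have hmem : diagSqrt lam (WithLp.toLp 2 (g i)) ∈ S :=
        Submodule.subset_span ⟨⟨i, hik⟩, rfl⟩
      have : Sᗮ.starProjection (diagSqrt lam (WithLp.toLp 2 (g i))) = 0 := by
        rw [Submodule.starProjection_apply_eq_zero_iff]
        exact Submodule.le_orthogonal_orthogonal S hmem
      rw [this, smul_zero]
  calc _ ≤ ∫⁻ y, (ENNReal.ofReal (‖T (WithLp.toLp 2 y)‖ ^ 2))⁻¹
        ∂(Measure.pi fun _ : ι => stdComplexGaussian) :=
        lintegral_mono fun y => ENNReal.inv_le_inv.2 (hlow y)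
    _ = ∫⁻ x, (ENNReal.ofReal (‖T x‖ ^ 2))⁻¹ ∂(stdComplexGaussianVec ι) := by
        rw [stdComplexGaussianVec, lintegral_map _ (by fun_prop)]
        refine (ENNReal.measurable_ofReal.comp ?_).inv
        exact ((LinearMap.continuous_of_finiteDimensional T).norm.pow 2).measurable
    -- The projection costs (K - 1) ℓ of trace, and the negative moment bound costs one more ℓ.
    _ ≤ ENNReal.ofReal (1 / (∑ m, lam m - (Fintype.card κ - 1) * ℓ - ℓ)) := by
        refine lintegral_inv_sq_norm_le T hℓ0 (fun x => ?_) (fun v => ?_) (by linarith)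
        · exact (hproj _).trans (norm_diagSqrt_sq_le h0 hℓ x)
        · have hsplit : ∑ i, ‖T (v i)‖ ^ 2 = ∑ i, ‖diagSqrt lam (v i)‖ ^ 2 -
              ∑ i, ‖S.starProjection (diagSqrt lam (v i))‖ ^ 2 := by
            rw [← Finset.sum_sub_distrib]
            refine Finset.sum_congr rfl fun i _ => ?_
            rw [hpyth (diagSqrt lam (v i))]
            simp [T]
          rw [hsplit, sum_norm_diagSqrt_sq h0]
          have h1 := sum_norm_starProjection_diagSqrt_sq_le h0 hℓ S v
          have h2 := mul_le_mul_of_nonneg_right hS hℓ0.le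
          linarith
    _ = _ := by
        congr 2
        ring

lemma lintegral_inv_colDistSq_le {lam : ι → ℝ} {ℓ : ℝ} (h0 : ∀ m, 0 ≤ lam m)
    (hℓ : ∀ m, lam m ≤ ℓ) (hℓ0 : 0 < ℓ) (hlt : Fintype.card κ * ℓ < ∑ m, lam m) (k : κ) :
    ∫⁻ g, (colDistSq lam k g)⁻¹
        ∂(Measure.pi fun _ : κ => Measure.pi fun _ : ι => stdComplexGaussian) ≤
      ENNReal.ofReal (1 / (∑ m, lam m - Fintype.card κ * ℓ)) := by
  classical
  have h := lintegral_le_of_lmarginal_le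
    (μ := fun _ : κ => Measure.pi fun _ : ι => stdComplexGaussian) {k}
    (f := fun g => (colDistSq lam k g)⁻¹)
    (g := fun _ => ENNReal.ofReal (1 / (∑ m, lam m - Fintype.card κ * ℓ)))
    (measurable_colDistSq lam k).inv measurable_const ?_
  · simpa using h
  · intro g
    rw [lmarginal_singleton, lmarginal_singleton]
    simpa using lintegral_inv_colDistSq_update_le h0 hℓ hℓ0 hlt k g

end Columns

/-! ### Diagonal entries of the inverse Gram matrix. -/

section Gram

variable {ι κ : Type*} [Fintype ι] [DecidableEq ι] [Fintype κ]

/-- The weighted Gram matrix `Gᴴ Λ G`. -/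
noncomputable def weightedGram (lam : ι → ℝ) (G : Matrix ι κ ℂ) : Matrix κ κ ℂ :=
  Gᴴ * Matrix.diagonal (fun m => ((lam m : ℝ) : ℂ)) * G

lemma star_dotProduct_weightedGram_mulVec (lam : ι → ℝ) (G : Matrix ι κ ℂ) (c : κ → ℂ) :
    star c ⬝ᵥ (weightedGram lam G *ᵥ c) =
      ((∑ m, lam m * ‖∑ i, c i * G m i‖ ^ 2 : ℝ) : ℂ) := by
  have h : ∀ m, (G *ᵥ c) m = ∑ i, c i * G m i := fun m => by
    simp [Matrix.mulVec, dotProduct, mul_comm]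
  rw [weightedGram, ← Matrix.mulVec_mulVec, ← Matrix.mulVec_mulVec, Matrix.dotProduct_mulVec,
    ← Matrix.star_mulVec]
  simp only [dotProduct, Matrix.mulVec_diagonal, Pi.star_apply]
  push_cast
  refine Finset.sum_congr rfl fun m _ => ?_
  rw [h, ← Complex.mul_conj', RCLike.star_def]
  ring

lemma weightedGram_posSemidef {lam : ι → ℝ} (h0 : ∀ m, 0 ≤ lam m) (G : Matrix ι κ ℂ) :
    (weightedGram lam G).PosSemidef := by
  refine Matrix.PosSemidef.conjTranspose_mul_mul_same ?_ G
  exact Matrix.PosSemidef.diagonal fun m => Complex.zero_le_real.2 (h0 m)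

lemma weightedGram_apply_self_re [DecidableEq κ] (lam : ι → ℝ) (G : Matrix ι κ ℂ) (k : κ) :
    (weightedGram lam G k k).re = ∑ m, lam m * ‖G m k‖ ^ 2 := by
  have h := star_dotProduct_weightedGram_mulVec lam G (Pi.single k 1)
  have h1 : ∀ m, ∑ i, (Pi.single k 1 : κ → ℂ) i * G m i = G m k := fun m => by
    simp [Pi.single_apply]
  simp_rw [h1] at h
  rw [← Complex.ofReal_re (∑ m, lam m * ‖G m k‖ ^ 2), ← h]
  simp [Pi.star_single]

section Inverse

variable [DecidableEq κ] {lam : ι → ℝ} {G : Matrix ι κ ℂ}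

/-- The `k`-th column of the inverse of the Gram matrix. -/
lemma weightedGram_mulVec_inv_col (hW : IsUnit (weightedGram lam G).det) (k : κ) :
    weightedGram lam G *ᵥ (fun i => (weightedGram lam G)⁻¹ i k) = Pi.single k 1 := by
  have h : (fun i => (weightedGram lam G)⁻¹ i k) = (weightedGram lam G)⁻¹ *ᵥ Pi.single k 1 := by
    ext i; simp
  rw [h, Matrix.mulVec_mulVec, Matrix.mul_nonsing_inv _ hW, Matrix.one_mulVec]

lemma weightedGram_inv_apply_self_pos (h0 : ∀ m, 0 ≤ lam m) (hW : IsUnit (weightedGram lam G).det)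
    (k : κ) : 0 < (weightedGram lam G)⁻¹ k k := by
  have hpd : (weightedGram lam G).PosDef :=
    (weightedGram_posSemidef h0 G).posDef_iff_isUnit.2 ((Matrix.isUnit_iff_isUnit_det _).2 hW)
  exact hpd.inv.diag_pos

lemma weightedGram_inv_eq_zero (hW : ¬ IsUnit (weightedGram lam G).det) :
    (weightedGram lam G)⁻¹ = 0 := Matrix.nonsing_inv_apply_not_isUnit _ hW

lemma weightedGram_inv_apply_self (h0 : ∀ m, 0 ≤ lam m) (k : κ) :
    (weightedGram lam G)⁻¹ k k = (((weightedGram lam G)⁻¹ k k).re : ℂ) := by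
  by_cases hW : IsUnit (weightedGram lam G).det
  · exact Complex.eq_re_of_ofReal_le (weightedGram_inv_apply_self_pos h0 hW k).le
  · simp [weightedGram_inv_eq_zero hW]

lemma weightedGram_inv_apply_self_re_nonneg (h0 : ∀ m, 0 ≤ lam m) (k : κ) :
    0 ≤ ((weightedGram lam G)⁻¹ k k).re := by
  by_cases hW : IsUnit (weightedGram lam G).det
  · exact (Complex.pos_iff.1 (weightedGram_inv_apply_self_pos h0 hW k)).1.le
  · simp [weightedGram_inv_eq_zero hW]

/-- The distance is an infimum, so one competitor suffices: column k of W⁻¹ divided by a, at which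
the quadratic form equals 1 / a. If W is singular, its inverse is 0 by convention and the bound is
trivial. -/
lemma ofReal_weightedGram_inv_le (h0 : ∀ m, 0 ≤ lam m) (k : κ) :
    ENNReal.ofReal ((weightedGram lam G)⁻¹ k k).re ≤ (colDistSq lam k fun i m => G m i)⁻¹ := by
  by_cases hW : IsUnit (weightedGram lam G).det
  · set a := ((weightedGram lam G)⁻¹ k k).re with ha
    have ha0 : 0 < a := (Complex.pos_iff.1 (weightedGram_inv_apply_self_pos h0 hW k)).1
    have hac : (weightedGram lam G)⁻¹ k k = (a : ℂ) := weightedGram_inv_apply_self h0 k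
    have haC : (a : ℂ) ≠ 0 := by exact_mod_cast ha0.ne'
    let c : κ → ℂ := fun i => (a : ℂ)⁻¹ * (weightedGram lam G)⁻¹ i k
    have hck : c k = 1 := by simp only [c, hac]; exact inv_mul_cancel₀ haC
    have hWc : weightedGram lam G *ᵥ c = Pi.single k (a : ℂ)⁻¹ := by
      have : c = (a : ℂ)⁻¹ • fun i => (weightedGram lam G)⁻¹ i k := rfl
      rw [this, Matrix.mulVec_smul, weightedGram_mulVec_inv_col hW]
      ext i
      by_cases hi : i = k
      · subst hi; simp
      · simp [hi]
    have hq := star_dotProduct_weightedGram_mulVec lam G c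
    rw [hWc, dotProduct_single, Pi.star_apply, hck, star_one, one_mul] at hq
    have hq' : ∑ m, lam m * ‖∑ i, c i * G m i‖ ^ 2 = a⁻¹ := by
      apply Complex.ofReal_injective
      rw [← hq, Complex.ofReal_inv]
    have hle : colDistSq lam k (fun i m => G m i) ≤ ENNReal.ofReal a⁻¹ := by
      rw [← hq']
      exact iInf_le (fun c : {c : κ → ℂ // c k = 1} =>
        ENNReal.ofReal (∑ m, lam m * ‖∑ i, c.1 i * G m i‖ ^ 2)) ⟨c, hck⟩
    rw [ENNReal.le_inv_iff_le_inv, ← ENNReal.ofReal_inv_of_pos ha0]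
    exact hle
  · simp [weightedGram_inv_eq_zero hW]

/-- With c = W⁻¹ e, where e is the k-th basis vector, the form of W at e - c / a equals Wₖₖ - 1 / a,
which is nonnegative. In the singular case the left side is 0⁻¹ = 0. -/
lemma inv_weightedGram_inv_le (h0 : ∀ m, 0 ≤ lam m) (k : κ) :
    (((weightedGram lam G)⁻¹ k k).re)⁻¹ ≤ ∑ m, lam m * ‖G m k‖ ^ 2 := by
  by_cases hW : IsUnit (weightedGram lam G).det
  · set W := weightedGram lam G with hWdef
    set a := (W⁻¹ k k).re with ha
    have ha0 : 0 < a := (Complex.pos_iff.1 (weightedGram_inv_apply_self_pos h0 hW k)).1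
    have hac : W⁻¹ k k = (a : ℂ) := weightedGram_inv_apply_self h0 k
    have haC : (a : ℂ) ≠ 0 := by exact_mod_cast ha0.ne'
    let c : κ → ℂ := fun i => W⁻¹ i k
    let e : κ → ℂ := Pi.single k 1
    have hWc : W *ᵥ c = e := weightedGram_mulVec_inv_col hW k
    have hherm : Wᴴ = W := (weightedGram_posSemidef h0 G).isHermitian
    have hnn := (weightedGram_posSemidef h0 G).dotProduct_mulVec_nonneg (e - (a : ℂ)⁻¹ • c)
    have hcWe : star c ⬝ᵥ (W *ᵥ e) = 1 := by
      rw [Matrix.dotProduct_mulVec, ← hherm, ← Matrix.star_mulVec, hWc]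
      simp [e]
    have heWe : star e ⬝ᵥ (W *ᵥ e) = W k k := by simp [e, Pi.star_single]
    have hexp : star (e - (a : ℂ)⁻¹ • c) ⬝ᵥ (W *ᵥ (e - (a : ℂ)⁻¹ • c)) = W k k - (a : ℂ)⁻¹ := by
      rw [Matrix.mulVec_sub, Matrix.mulVec_smul, hWc, star_sub, star_smul, sub_dotProduct,
        dotProduct_sub, dotProduct_sub, smul_dotProduct, smul_dotProduct, hcWe, heWe]
      have h1 : star c ⬝ᵥ e = a := by
        simp only [e, dotProduct_single, Pi.star_apply, c, hac]
        simp
      have h2 : star e ⬝ᵥ e = 1 := by simp [e, Pi.star_single]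
      rw [dotProduct_smul, dotProduct_smul, h1, h2]
      have : star ((a : ℂ)⁻¹) = (a : ℂ)⁻¹ := by simp
      rw [this]
      simp only [smul_eq_mul]
      field_simp
      ring
    rw [← hWdef, hexp] at hnn
    have := (Complex.nonneg_iff.1 hnn).1
    rw [Complex.sub_re, weightedGram_apply_self_re, ← Complex.ofReal_inv, Complex.ofReal_re] at this
    linarith
  · rw [weightedGram_inv_eq_zero hW]
    simp only [Matrix.zero_apply, Complex.zero_re, inv_zero]
    exact Finset.sum_nonneg fun m _ => mul_nonneg (h0 m) (sq_nonneg _)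

/-- A kernel vector, rescaled to have some nonzero coordinate k equal to 1, would make the k-th
distance vanish. -/
lemma isUnit_det_weightedGram (hX : ∀ k, colDistSq lam k (fun i m => G m i) ≠ 0) :
    IsUnit (weightedGram lam G).det := by
  rw [isUnit_iff_ne_zero]
  intro hdet
  obtain ⟨c, hc, hWc⟩ := Matrix.exists_mulVec_eq_zero_iff.2 hdet
  obtain ⟨k, hk⟩ := Function.ne_iff.1 hc
  refine hX k (le_antisymm ?_ zero_le)
  have hq := star_dotProduct_weightedGram_mulVec lam G ((c k)⁻¹ • c)
  rw [Matrix.mulVec_smul, hWc, smul_zero, dotProduct_zero] at hq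
  have hq' : ∑ m, lam m * ‖∑ i, ((c k)⁻¹ • c) i * G m i‖ ^ 2 = 0 := by exact_mod_cast hq.symm
  refine (iInf_le _ ⟨(c k)⁻¹ • c, by simpa using inv_mul_cancel₀ hk⟩).trans_eq ?_
  simp only [hq', ENNReal.ofReal_zero]

end Inverse

end Gram

/-! ### Reduction of the zero-forcing SINR to the Gram matrix. -/

lemma norm_sq_phaseShift (θ φ : ℝ) : ‖phaseShift θ φ‖ ^ 2 = Real.cos φ ^ 2 := by
  have h : phaseShift θ φ = Complex.exp ((-θ : ℝ) * Complex.I) * ((Real.cos φ : ℝ) : ℂ) := by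
    rw [phaseShift, Complex.ofReal_cos, Complex.cos, mul_div_assoc', mul_add, ← Complex.exp_add,
      ← Complex.exp_add, ← add_div]
    push_cast
    ring_nf
  rw [h, norm_mul, Complex.norm_exp_ofReal_mul_I, one_mul, Complex.norm_real, Real.norm_eq_abs,
    sq_abs]

lemma steeringMatrix_conjTranspose_mul_self (w d ϑ : ℝ) (M : ℕ) :
    (steeringMatrix w d ϑ M)ᴴ * steeringMatrix w d ϑ M = 1 := by
  rw [steeringMatrix, Matrix.diagonal_conjTranspose, Matrix.diagonal_mul_diagonal,
    ← Matrix.diagonal_one]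
  congr 1
  ext m
  rw [Pi.star_apply, RCLike.star_def, Complex.conj_mul', ← mul_neg, ← Complex.ofReal_neg, mul_comm,
    Complex.norm_exp_ofReal_mul_I]
  simp

lemma responseMatrix_conjTranspose_mul_self {ρ : ℝ} (hρ : 0 < ρ) (θ φ w d ϑ : ℝ) (M : ℕ) :
    (responseMatrix ρ θ φ w d ϑ M)ᴴ * responseMatrix ρ θ φ w d ϑ M =
      ((ρ * Real.cos φ ^ 2 : ℝ) : ℂ) • (1 : Matrix (Fin M) (Fin M) ℂ) := by
  rw [responseMatrix, Matrix.conjTranspose_smul, Matrix.smul_mul, Matrix.mul_smul, smul_smul,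
    steeringMatrix_conjTranspose_mul_self]
  congr 1
  rw [RCLike.star_def, Complex.conj_mul', norm_mul, ← Complex.ofReal_pow,
    mul_pow, norm_sq_phaseShift, Complex.norm_real,
    Real.norm_eq_abs, sq_abs, Real.sq_sqrt hρ.le]

lemma cfcChannel_conjTranspose_mul_self {M K : ℕ} {U : Matrix (Fin M) (Fin M) ℂ}
    (hU : U ∈ Matrix.unitaryGroup (Fin M) ℂ) {lam : Fin M → ℝ} (h0 : ∀ m, 0 ≤ lam m)
    (β : Fin K → ℝ) (G : Matrix (Fin M) (Fin K) ℂ) :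
    (cfcChannel U lam β G)ᴴ * cfcChannel U lam β G =
      Matrix.diagonal (fun i => ((√(β i) : ℝ) : ℂ)) * weightedGram lam G *
        Matrix.diagonal (fun i => ((√(β i) : ℝ) : ℂ)) := by
  have hS : Matrix.hadamard (Matrix.vecMulVec (fun m => ((√(lam m) : ℝ) : ℂ))
      (fun _ : Fin K => (1 : ℂ))) G = Matrix.diagonal (fun m => ((√(lam m) : ℝ) : ℂ)) * G := by
    ext m i
    simp [Matrix.vecMulVec_apply]
  have hd : ∀ {n : ℕ} (x : Fin n → ℝ), (Matrix.diagonal (fun i => ((x i : ℝ) : ℂ)))ᴴ =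
      Matrix.diagonal (fun i => ((x i : ℝ) : ℂ)) := fun x => by
    rw [Matrix.diagonal_conjTranspose]
    congr 1
    ext i
    simp
  have hUU : Uᴴ * U = 1 := Matrix.mem_unitaryGroup_iff'.1 hU
  have hss : Matrix.diagonal (fun m => ((√(lam m) : ℝ) : ℂ)) *
      Matrix.diagonal (fun m => ((√(lam m) : ℝ) : ℂ)) =
      Matrix.diagonal (fun m => ((lam m : ℝ) : ℂ)) := by
    rw [Matrix.diagonal_mul_diagonal]
    congr 1
    ext m
    rw [← Complex.ofReal_mul, Real.mul_self_sqrt (h0 m)]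
  rw [cfcChannel, hS, weightedGram, ← hss]
  simp only [Matrix.conjTranspose_mul, hd]
  simp only [Matrix.mul_assoc]
  rw [← Matrix.mul_assoc Uᴴ U, hUU, Matrix.one_mul]

/-- The post-combining SINR of zero forcing is proportional to `1 / [(Gᴴ Λ G)⁻¹]ₖₖ`, with the value
`0` when the Gram matrix is singular. -/
lemma zfRate_eq {M K : ℕ} {P σ ρ : ℝ} (hP : 0 < P) (hσ : 0 < σ) (hρ : 0 < ρ) {β : Fin K → ℝ}
    (hβ : ∀ i, 0 < β i) (θ φ w d ϑ : ℝ) {U : Matrix (Fin M) (Fin M) ℂ}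
    (hU : U ∈ Matrix.unitaryGroup (Fin M) ℂ) {lam : Fin M → ℝ} (h0 : ∀ m, 0 ≤ lam m)
    (G : Matrix (Fin M) (Fin K) ℂ) (k : Fin K) :
    zfRate P σ (responseMatrix ρ θ φ w d ϑ M) (cfcChannel U lam β G) k =
      Real.logb 2 (1 + snrOne ρ P σ (β k) * Real.cos φ ^ 2 *
        (((weightedGram lam G)⁻¹ k k).re)⁻¹) := by
  set Θ := responseMatrix ρ θ φ w d ϑ M with hΘ
  set H := cfcChannel U lam β G with hH
  set W := weightedGram lam G with hWdef
  set B := Matrix.diagonal (fun i => ((√(β i) : ℝ) : ℂ)) with hB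
  set τ : ℝ := ρ * Real.cos φ ^ 2 with hτ
  have hA : Hᴴ * Θᴴ * Θ * H = (τ : ℂ) • (B * W * B) := by
    rw [Matrix.mul_assoc Hᴴ, responseMatrix_conjTranspose_mul_self hρ, Matrix.mul_smul,
      Matrix.mul_one, Matrix.smul_mul, hH, cfcChannel_conjTranspose_mul_self hU h0]
  have hBdet : IsUnit B.det := by
    rw [hB, Matrix.det_diagonal, isUnit_iff_ne_zero, Finset.prod_ne_zero_iff]
    intro i _
    exact_mod_cast (Real.sqrt_pos.2 (hβ i)).ne'
  rw [zfRate]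
  congr 2
  by_cases hdeg : IsUnit (Hᴴ * Θᴴ * Θ * H).det
  swap
  · have hC : zfCombiner Θ H = 0 := by
      rw [zfCombiner, Matrix.nonsing_inv_apply_not_isUnit _ hdeg, Matrix.mul_zero]
    have hleft : sinr P σ Θ H (zfCombiner Θ H) k = 0 := by
      rw [hC, sinr]
      simp
    rw [hleft]
    -- The inverted matrix is singular either because cos φ = 0 or because W is singular; in both
    -- cases the right side also degenerates to SINR 0, by a zero factor or by 0⁻¹ = 0.
    by_cases hW : IsUnit W.det
    · have hτ0 : τ = 0 := by
        by_contra hne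
        refine hdeg ?_
        rw [hA, Matrix.det_smul, Matrix.det_mul, Matrix.det_mul]
        refine IsUnit.mul ?_ ((hBdet.mul hW).mul hBdet)
        rw [isUnit_iff_ne_zero]
        exact pow_ne_zero _ (by exact_mod_cast hne)
      have hcos : Real.cos φ ^ 2 = 0 := (mul_eq_zero.1 hτ0).resolve_left hρ.ne'
      rw [hcos]
      simp
    · rw [weightedGram_inv_eq_zero hW]
      simp
  · set A := Hᴴ * Θᴴ * Θ * H with hAdef
    have hdet := hdeg
    rw [hA, Matrix.det_smul, Matrix.det_mul, Matrix.det_mul, isUnit_iff_ne_zero] at hdet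
    have hW : IsUnit W.det := isUnit_iff_ne_zero.2 fun h => hdet (by rw [h]; simp)
    have hτC : (τ : ℂ) ≠ 0 := by
      intro h
      refine hdet ?_
      -- The determinant carries the factor τ^K, which vanishes at τ = 0 only because K ≥ 1.
      have : Fintype.card (Fin K) ≠ 0 := (Fintype.card_pos_iff.2 ⟨k⟩).ne'
      rw [h, zero_pow this, zero_mul]
    have hAherm : Aᴴ = A := by
      rw [hAdef]
      simp [Matrix.mul_assoc]
    have hAinvherm : (A⁻¹)ᴴ = A⁻¹ := by rw [Matrix.conjTranspose_nonsing_inv, hAherm]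
    have hCH : (zfCombiner Θ H)ᴴ * Θ * H = 1 := by
      rw [zfCombiner, ← hAdef, Matrix.conjTranspose_mul, hAinvherm, Matrix.conjTranspose_mul,
        Matrix.mul_assoc, Matrix.mul_assoc, ← Matrix.mul_assoc (Hᴴ * Θᴴ), ← hAdef,
        Matrix.nonsing_inv_mul _ hdeg]
    have hCC : (zfCombiner Θ H)ᴴ * zfCombiner Θ H = A⁻¹ := by
      have : zfCombiner Θ H = Θ * H * A⁻¹ := rfl
      calc (zfCombiner Θ H)ᴴ * zfCombiner Θ H = (zfCombiner Θ H)ᴴ * (Θ * H * A⁻¹) := by rw [← this]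
        _ = A⁻¹ := by rw [← Matrix.mul_assoc, ← Matrix.mul_assoc, hCH, Matrix.one_mul]
    have hAinv : A⁻¹ k k = (((τ * β k)⁻¹ * (W⁻¹ k k).re : ℝ) : ℂ) := by
      have hinv : A⁻¹ = (τ : ℂ)⁻¹ • (B⁻¹ * W⁻¹ * B⁻¹) := by
        refine Matrix.inv_eq_right_inv ?_
        rw [hA, Matrix.smul_mul, Matrix.mul_smul, smul_smul, mul_inv_cancel₀ hτC, one_smul]
        simp only [Matrix.mul_assoc]
        rw [← Matrix.mul_assoc B B⁻¹, Matrix.mul_nonsing_inv _ hBdet, Matrix.one_mul,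
          ← Matrix.mul_assoc W W⁻¹, Matrix.mul_nonsing_inv _ hW, Matrix.one_mul,
          Matrix.mul_nonsing_inv _ hBdet]
      have hBinv : B⁻¹ = Matrix.diagonal (fun i => ((√(β i) : ℝ) : ℂ)⁻¹) := by
        refine Matrix.inv_eq_right_inv ?_
        rw [hB, Matrix.diagonal_mul_diagonal, ← Matrix.diagonal_one]
        congr 1
        ext i
        exact mul_inv_cancel₀ (by exact_mod_cast (Real.sqrt_pos.2 (hβ i)).ne')
      rw [hinv, hBinv, Matrix.smul_apply, Matrix.mul_diagonal, Matrix.diagonal_mul,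
        weightedGram_inv_apply_self h0 k, smul_eq_mul]
      have hsq : ((√(β k) : ℝ) : ℂ)⁻¹ * ((√(β k) : ℝ) : ℂ)⁻¹ = ((β k : ℝ) : ℂ)⁻¹ := by
        rw [← mul_inv, ← Complex.ofReal_mul, Real.mul_self_sqrt (hβ k).le]
      push_cast
      rw [mul_inv, ← hsq, ← hWdef]
      simp only [Complex.ofReal_re]
      ring
    have hnorm : ∑ m, ‖zfCombiner Θ H m k‖ ^ 2 = (τ * β k)⁻¹ * (W⁻¹ k k).re := by
      apply Complex.ofReal_injective
      rw [← hAinv, ← hCC, Matrix.mul_apply]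
      push_cast
      refine Finset.sum_congr rfl fun m _ => ?_
      rw [Matrix.conjTranspose_apply, RCLike.star_def, Complex.conj_mul']
    have hoff : ∑ i ∈ Finset.univ.erase k, ‖(1 : Matrix (Fin K) (Fin K) ℂ) k i‖ ^ 2 = 0 := by
      refine Finset.sum_eq_zero fun i hi => ?_
      rw [Matrix.one_apply_ne (Finset.ne_of_mem_erase hi).symm]
      simp
    rw [sinr, hCH, hoff, hnorm, Matrix.one_apply_eq, snrOne, hτ]
    have ha0 : (W⁻¹ k k).re ≠ 0 :=
      (Complex.pos_iff.1 (weightedGram_inv_apply_self_pos h0 hW k)).1.ne'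
    have hcos : Real.cos φ ≠ 0 := by
      intro h
      refine hτC ?_
      rw [hτ, h]
      simp
    have := (hβ k).ne'
    simp only [norm_one, one_pow, mul_one, mul_zero, zero_add]
    field_simp

/-! ### Jakes' model satisfies the general spectral assumptions. -/

section Jakes

lemma besselJ0_zero : besselJ0 0 = 1 := by
  simp [besselJ0, Real.pi_ne_zero]

lemma besselJ0_abs (x : ℝ) : besselJ0 |x| = besselJ0 x := by
  rcases abs_choice x with h | h <;> rw [h]
  simp [besselJ0]

/-- The arcsine law: `J₀` is the Fourier cosine transform of `(1 - u²)^{-1/2}`. -/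
lemma besselJ0_eq_integral_Ioo (x : ℝ) :
    besselJ0 x = (2 / Real.pi) * ∫ t in Set.Ioo 0 (Real.pi / 2), Real.cos (x * Real.sin t) := by
  have hpi := Real.pi_pos
  have hcont : Continuous fun t => Real.cos (x * Real.sin t) := by fun_prop
  have h1 : ∫ t in (0 : ℝ)..Real.pi, Real.cos (x * Real.sin t) =
      (∫ t in (0 : ℝ)..Real.pi / 2, Real.cos (x * Real.sin t)) +
        ∫ t in Real.pi / 2..Real.pi, Real.cos (x * Real.sin t) :=
    (intervalIntegral.integral_add_adjacent_intervals (hcont.intervalIntegrable _ _)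
      (hcont.intervalIntegrable _ _)).symm
  have h2 : ∫ t in Real.pi / 2..Real.pi, Real.cos (x * Real.sin t) =
      ∫ t in (0 : ℝ)..Real.pi / 2, Real.cos (x * Real.sin t) := by
    have := intervalIntegral.integral_comp_sub_left (a := 0) (b := Real.pi / 2)
      (fun t => Real.cos (x * Real.sin t)) Real.pi
    simp only [Real.sin_pi_sub, sub_zero] at this
    rw [this]
    congr 1
    ring
  rw [besselJ0, h1, h2, intervalIntegral.integral_of_le (by linarith),
    integral_Ioc_eq_integral_Ioo]
  ring

/-- Substituting u = sin t presents J₀ as the real part of a Fourier integral of (1 - u²)^{-1/2} on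
(0, 1), and the Riemann–Lebesgue lemma applies. In `f` the density is written through cos (arcsin u)
so that it cancels the Jacobian. -/
lemma tendsto_besselJ0_atTop : Tendsto besselJ0 atTop (𝓝 0) := by
  have hpi := Real.pi_pos
  let f : ℝ → ℂ := Set.indicator (Real.sin '' Set.Ioo 0 (Real.pi / 2))
    fun u => ((|Real.cos (Real.arcsin u)|⁻¹ : ℝ) : ℂ)
  have hmem : ∀ t ∈ Set.Ioo (0 : ℝ) (Real.pi / 2), t ∈ Set.Icc (-(Real.pi / 2)) (Real.pi / 2) :=
    fun t ht => ⟨by linarith [ht.1], ht.2.le⟩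
  have hinj : Set.InjOn Real.sin (Set.Ioo 0 (Real.pi / 2)) :=
    Real.injOn_sin.mono hmem
  have himg : MeasurableSet (Real.sin '' Set.Ioo 0 (Real.pi / 2)) :=
    measurableSet_Ioo.image_of_continuousOn_injOn Real.continuous_sin.continuousOn hinj
  have hfour : ∀ x : ℝ, (∫ v : ℝ, Real.fourierChar (-(v * (x / (2 * Real.pi)))) • f v) =
      ∫ t in Set.Ioo 0 (Real.pi / 2), Complex.exp (-(((x * Real.sin t : ℝ) : ℂ) * Complex.I)) := by
    intro x
    have h1 : (fun v : ℝ => Real.fourierChar (-(v * (x / (2 * Real.pi)))) • f v) =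
        Set.indicator (Real.sin '' Set.Ioo 0 (Real.pi / 2)) fun u =>
          Complex.exp (-(((x * u : ℝ) : ℂ) * Complex.I)) *
            ((|Real.cos (Real.arcsin u)|⁻¹ : ℝ) : ℂ) := by
      ext v
      simp only [f]
      by_cases hv : v ∈ Real.sin '' Set.Ioo 0 (Real.pi / 2)
      · rw [Set.indicator_of_mem hv, Set.indicator_of_mem hv, Circle.smul_def,
          Real.fourierChar_apply, smul_eq_mul]
        congr 2
        push_cast
        field_simp
      · rw [Set.indicator_of_notMem hv, Set.indicator_of_notMem hv, smul_zero]
    rw [h1, integral_indicator himg, integral_image_eq_integral_abs_deriv_smul measurableSet_Ioo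
      (fun t _ => (Real.hasDerivAt_sin t).hasDerivWithinAt) hinj]
    refine setIntegral_congr_fun measurableSet_Ioo fun t ht => ?_
    have hc : 0 < |Real.cos t| :=
      abs_pos.2 (Real.cos_pos_of_mem_Ioo ⟨by linarith [ht.1], ht.2⟩).ne'
    rw [Real.arcsin_sin (hmem t ht).1 (hmem t ht).2, Complex.real_smul, mul_left_comm,
      ← Complex.ofReal_mul, mul_inv_cancel₀ hc.ne']
    simp
  have hlim := (Real.tendsto_integral_exp_smul_cocompact f).comp
    (atTop_le_cocompact.trans' (tendsto_id.atTop_div_const (r := 2 * Real.pi) (by positivity)) :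
      Tendsto (fun x : ℝ => x / (2 * Real.pi)) atTop (cocompact ℝ))
  have hre : ∀ x, besselJ0 x = (2 / Real.pi) *
      ((∫ v : ℝ, Real.fourierChar (-(v * (x / (2 * Real.pi)))) • f v)).re := by
    intro x
    rw [hfour, besselJ0_eq_integral_Ioo]
    have hint : IntegrableOn (fun t : ℝ => Complex.exp (-(((x * Real.sin t : ℝ) : ℂ) * Complex.I)))
        (Set.Ioo 0 (Real.pi / 2)) :=
      ((Continuous.integrableOn_Icc (by fun_prop)).mono_set Set.Ioo_subset_Icc_self)
    have := integral_re (𝕜 := ℂ) hint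
    simp only [RCLike.re_to_complex] at this
    rw [← this]
    congr 1
    refine setIntegral_congr_fun measurableSet_Ioo fun t _ => ?_
    rw [← neg_mul, ← Complex.ofReal_neg, Complex.exp_ofReal_mul_I_re, Real.cos_neg]
  have h2 := ((Complex.continuous_re.tendsto 0).comp hlim).const_mul (2 / Real.pi)
  simp only [Complex.zero_re, mul_zero] at h2
  exact h2.congr fun x => (hre x).symm

lemma jakesMatrix_apply (ϖ : ℝ) (M : ℕ) (i j : Fin M) :
    jakesMatrix ϖ M i j = ((besselJ0 (ϖ * ((i : ℕ) : ℝ) - ϖ * ((j : ℕ) : ℝ)) : ℝ) : ℂ) := by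
  rw [jakesMatrix, Matrix.of_apply, ← besselJ0_abs, abs_mul, abs_abs, ← abs_mul, besselJ0_abs,
    mul_sub]

lemma jakesMatrix_isHermitian (ϖ : ℝ) (M : ℕ) : (jakesMatrix ϖ M).IsHermitian := by
  ext i j
  rw [Matrix.conjTranspose_apply, RCLike.star_def, jakesMatrix_apply, jakesMatrix_apply,
    Complex.conj_ofReal, ← besselJ0_abs, abs_sub_comm, besselJ0_abs]

/-- The entries average cos (αᵢ - αⱼ) = cos αᵢ cos αⱼ + sin αᵢ sin αⱼ over t, with αᵢ = ϖ i sin t.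
For each t the quadratic form is thus ‖C t‖² + ‖S t‖². -/
lemma jakesMatrix_posSemidef (ϖ : ℝ) (M : ℕ) : (jakesMatrix ϖ M).PosSemidef := by
  refine Matrix.PosSemidef.of_dotProduct_mulVec_nonneg (jakesMatrix_isHermitian ϖ M) fun x => ?_
  let C : ℝ → ℂ := fun t => ∑ i, x i * ((Real.cos (ϖ * ((i : ℕ) : ℝ) * Real.sin t) : ℝ) : ℂ)
  let S : ℝ → ℂ := fun t => ∑ i, x i * ((Real.sin (ϖ * ((i : ℕ) : ℝ) * Real.sin t) : ℝ) : ℂ)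
  have hpt : ∀ t : ℝ, ∑ i, ∑ j, star (x i) * x j *
      ((Real.cos ((ϖ * ((i : ℕ) : ℝ) - ϖ * ((j : ℕ) : ℝ)) * Real.sin t) : ℝ) : ℂ) =
      ((‖C t‖ ^ 2 + ‖S t‖ ^ 2 : ℝ) : ℂ) := by
    intro t
    rw [Complex.ofReal_add, Complex.ofReal_pow, Complex.ofReal_pow, ← Complex.conj_mul', ← Complex.conj_mul']
    simp only [C, S, map_sum, map_mul, Complex.conj_ofReal, Finset.sum_mul_sum]
    rw [← Finset.sum_add_distrib]
    refine Finset.sum_congr rfl fun i _ => ?_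
    rw [← Finset.sum_add_distrib]
    refine Finset.sum_congr rfl fun j _ => ?_
    rw [sub_mul, Real.cos_sub, RCLike.star_def, Complex.ofReal_add, Complex.ofReal_mul,
      Complex.ofReal_mul]
    ring
  have hmain : star x ⬝ᵥ (jakesMatrix ϖ M *ᵥ x) =
      (((1 / Real.pi) * ∫ t in (0 : ℝ)..Real.pi, (‖C t‖ ^ 2 + ‖S t‖ ^ 2) : ℝ) : ℂ) := by
    rw [Complex.ofReal_mul, ← intervalIntegral.integral_ofReal]
    simp_rw [← hpt]
    rw [intervalIntegral.integral_finsetSum fun i _ =>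
      Continuous.intervalIntegrable (by fun_prop) _ _]
    simp only [dotProduct, Matrix.mulVec, Finset.mul_sum]
    refine Finset.sum_congr rfl fun i _ => ?_
    rw [intervalIntegral.integral_finsetSum fun j _ =>
      Continuous.intervalIntegrable (by fun_prop) _ _, Finset.mul_sum]
    refine Finset.sum_congr rfl fun j _ => ?_
    rw [intervalIntegral.integral_const_mul, intervalIntegral.integral_ofReal, jakesMatrix_apply,
      besselJ0, Pi.star_apply]
    push_cast
    ring
  rw [hmain]
  refine Complex.zero_le_real.2 (mul_nonneg (by positivity) ?_)
  exact intervalIntegral.integral_nonneg Real.pi_pos.le fun t _ => by positivity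

lemma jakesMatrix_trace (ϖ : ℝ) (M : ℕ) : (jakesMatrix ϖ M).trace = (M : ℂ) := by
  simp [Matrix.trace, jakesMatrix_apply, besselJ0_zero]

lemma jakesMatrix_mul_self_trace_re (ϖ : ℝ) (M : ℕ) :
    ((jakesMatrix ϖ M * jakesMatrix ϖ M).trace).re =
      ∑ i : Fin M, ∑ j : Fin M, besselJ0 (ϖ * |((i : ℕ) : ℝ) - ((j : ℕ) : ℝ)|) ^ 2 := by
  simp only [Matrix.trace, Matrix.diag_apply, Matrix.mul_apply, Complex.re_sum]
  refine Finset.sum_congr rfl fun i _ => Finset.sum_congr rfl fun j _ => ?_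
  rw [jakesMatrix, Matrix.of_apply, Matrix.of_apply, abs_sub_comm ((j : ℕ) : ℝ),
    ← Complex.ofReal_mul, Complex.ofReal_re, sq]

/-- A row sum of a Toeplitz matrix is at most twice the sum of its first column. -/
lemma sum_range_toeplitz_le {r : ℕ → ℝ} (hr : ∀ n, 0 ≤ r n) {M i : ℕ} (hi : i < M) :
    ∑ j ∈ Finset.range M, r (max i j - min i j) ≤ 2 * ∑ n ∈ Finset.range M, r n := by
  -- The diagonal term j = i is counted in both halves, which is harmless since r ≥ 0.
  have hsplit : ∑ j ∈ Finset.range M, r (max i j - min i j) ≤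
      ∑ j ∈ Finset.range (i + 1), r (i - j) + ∑ j ∈ Finset.Ico i M, r (j - i) := by
    rw [← Finset.sum_range_add_sum_Ico _ (show i + 1 ≤ M from hi)]
    refine add_le_add (Finset.sum_le_sum fun j hj => ?_) ?_
    · have : j ≤ i := Nat.lt_succ_iff.1 (Finset.mem_range.1 hj)
      rw [max_eq_left this, min_eq_right this]
    · refine (Finset.sum_le_sum fun j hj => le_of_eq ?_).trans
        (Finset.sum_le_sum_of_subset_of_nonneg
          (Finset.Ico_subset_Ico_left (Nat.le_succ i)) fun j _ _ => hr (j - i))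
      have : i ≤ j := by have := (Finset.mem_Ico.1 hj).1; omega
      rw [max_eq_right this, min_eq_left this]
  have h1 : ∑ j ∈ Finset.range (i + 1), r (i - j) ≤ ∑ n ∈ Finset.range M, r n := by
    have := Finset.sum_range_reflect r (i + 1)
    simp only [Nat.add_sub_cancel] at this
    rw [this]
    exact Finset.sum_le_sum_of_subset_of_nonneg
      (Finset.range_subset_range.2 hi) fun j _ _ => hr j
  have h2 : ∑ j ∈ Finset.Ico i M, r (j - i) ≤ ∑ n ∈ Finset.range M, r n := by
    rw [Finset.sum_Ico_eq_sum_range]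
    simp only [Nat.add_sub_cancel_left]
    exact Finset.sum_le_sum_of_subset_of_nonneg
      (Finset.range_subset_range.2 (Nat.sub_le M i)) fun j _ _ => hr j
  linarith

/-- Each row sum of squared entries is at most twice ∑ J₀(ϖ n)² over n < M; after division by M² the
total is bounded by twice a Cesàro mean of a null sequence. -/
lemma tendsto_jakesMatrix_mul_self_trace {ϖ : ℝ} (hϖ : 0 < ϖ) :
    Tendsto (fun M : ℕ => ((jakesMatrix ϖ M * jakesMatrix ϖ M).trace).re / (M : ℝ) ^ 2)
      atTop (𝓝 0) := by
  let r : ℕ → ℝ := fun n => besselJ0 (ϖ * n) ^ 2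
  have hr : Tendsto r atTop (𝓝 0) := by
    have := (tendsto_besselJ0_atTop.comp
      (tendsto_natCast_atTop_atTop.const_mul_atTop hϖ)).pow 2
    simpa [r, Function.comp_def] using this
  have hces := (hr.cesaro).const_mul 2
  rw [mul_zero] at hces
  have habs : ∀ i j : ℕ, |(i : ℝ) - j| = ((max i j - min i j : ℕ) : ℝ) := by
    intro i j
    rcases le_total i j with h | h
    · rw [max_eq_right h, min_eq_left h, Nat.cast_sub h, abs_sub_comm,
        abs_of_nonneg (sub_nonneg.2 (by exact_mod_cast h))]
    · rw [max_eq_left h, min_eq_right h, Nat.cast_sub h,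
        abs_of_nonneg (sub_nonneg.2 (by exact_mod_cast h))]
  refine squeeze_zero (fun M => ?_) (fun M => ?_) hces
  · rw [jakesMatrix_mul_self_trace_re]
    positivity
  · rw [jakesMatrix_mul_self_trace_re]
    have hrow : ∀ i : Fin M, ∑ j : Fin M, besselJ0 (ϖ * |((i : ℕ) : ℝ) - ((j : ℕ) : ℝ)|) ^ 2 ≤
        2 * ∑ n ∈ Finset.range M, r n := by
      intro i
      simp_rw [habs]
      rw [Fin.sum_univ_eq_sum_range
        (fun j => besselJ0 (ϖ * ((max (i : ℕ) j - min (i : ℕ) j : ℕ) : ℝ)) ^ 2) M]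
      exact sum_range_toeplitz_le (r := r) (fun n => sq_nonneg _) i.2
    have htot := Finset.sum_le_sum fun (i : Fin M) (_ : i ∈ Finset.univ) => hrow i
    rw [Finset.sum_const, Finset.card_univ, Fintype.card_fin, nsmul_eq_mul] at htot
    rcases Nat.eq_zero_or_pos M with rfl | hM
    · simp
    · have hM' : (0 : ℝ) < M := by exact_mod_cast hM
      rw [div_le_iff₀ (by positivity)]
      refine htot.trans_eq ?_
      field_simp

end Jakes

/-! ### Two-sided bounds on the expected rate for fixed M. -/

section FixedSize

variable {Ω : Type*} [MeasurableSpace Ω] {μ : Measure Ω} [IsProbabilityMeasure μ] {M K : ℕ}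
  {G : Ω → Matrix (Fin M) (Fin K) ℂ}

omit [IsProbabilityMeasure μ] in
lemma aemeasurable_columns (hlaw : ∀ m i, HasLaw (fun ω => G ω m i) stdComplexGaussian μ) :
    AEMeasurable (fun ω (i : Fin K) (m : Fin M) => G ω m i) μ :=
  aemeasurable_pi_lambda _ fun i => aemeasurable_pi_lambda _ fun m => (hlaw m i).aemeasurable

lemma map_columns (hlaw : ∀ m i, HasLaw (fun ω => G ω m i) stdComplexGaussian μ)
    (hindep : iIndepFun (fun (p : Fin M × Fin K) ω => G ω p.1 p.2) μ) :
    μ.map (fun ω (i : Fin K) (m : Fin M) => G ω m i) =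
      Measure.pi fun _ : Fin K => Measure.pi fun _ : Fin M => stdComplexGaussian := by
  have h1 : iIndepFun (fun (p : Fin K × Fin M) ω => G ω p.2 p.1) μ :=
    hindep.precomp (g := Prod.swap) Prod.swap_injective
  have hm : ∀ p : Fin K × Fin M, AEMeasurable (fun ω => G ω p.2 p.1) μ :=
    fun p => (hlaw p.2 p.1).aemeasurable
  rw [iIndepFun_iff_map_fun_eq_pi_map hm] at h1
  simp_rw [fun p : Fin K × Fin M => (hlaw p.2 p.1).map_eq] at h1
  -- Currying turns the product law over pairs into the law of K independent columns.
  have h2 := Measure.infinitePi_map_curry (ι := Fin K) (κ := Fin M)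
    (fun _ _ => stdComplexGaussian)
  simp_rw [Measure.infinitePi_eq_pi] at h2
  rw [← h2, ← h1, AEMeasurable.map_map_of_aemeasurable
    (MeasurableEquiv.measurable _).aemeasurable (aemeasurable_pi_lambda _ hm)]
  rfl

lemma measurable_weightedGram_inv (lam : Fin M → ℝ) (k : Fin K) :
    Measurable fun g : Fin K → Fin M → ℂ =>
      ((weightedGram lam (Matrix.of fun m i => g i m))⁻¹ k k).re := by
  have hW : Continuous fun g : Fin K → Fin M → ℂ =>
      weightedGram lam (Matrix.of fun m i => g i m) := by
    have hG : Continuous fun g : Fin K → Fin M → ℂ =>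
        (Matrix.of fun m i => g i m : Matrix (Fin M) (Fin K) ℂ) :=
      continuous_matrix fun m i => by simp only [Matrix.of_apply]; fun_prop
    exact (hG.matrix_conjTranspose.matrix_mul continuous_const).matrix_mul hG
  simp_rw [Matrix.inv_def, Ring.inverse_eq_inv', Matrix.smul_apply, smul_eq_mul]
  refine Complex.measurable_re.comp ((hW.matrix_det.measurable.inv).mul ?_)
  exact (hW.matrix_adjugate.matrix_elem k k).measurable

omit [IsProbabilityMeasure μ] in
lemma aemeasurable_weightedGram_inv
    (hlaw : ∀ m i, HasLaw (fun ω => G ω m i) stdComplexGaussian μ) (lam : Fin M → ℝ) (k : Fin K) :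
    AEMeasurable (fun ω => ((weightedGram lam (G ω))⁻¹ k k).re) μ :=
  (measurable_weightedGram_inv lam k).comp_aemeasurable (aemeasurable_columns hlaw)

lemma lintegral_inv_colDistSq_comp_le
    (hlaw : ∀ m i, HasLaw (fun ω => G ω m i) stdComplexGaussian μ)
    (hindep : iIndepFun (fun (p : Fin M × Fin K) ω => G ω p.1 p.2) μ) {lam : Fin M → ℝ} {ℓ : ℝ}
    (h0 : ∀ m, 0 ≤ lam m) (hℓ : ∀ m, lam m ≤ ℓ) (hℓ0 : 0 < ℓ) (hlt : K * ℓ < ∑ m, lam m)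
    (k : Fin K) :
    ∫⁻ ω, (colDistSq lam k fun i m => G ω m i)⁻¹ ∂μ ≤
      ENNReal.ofReal (1 / (∑ m, lam m - K * ℓ)) := by
  have h := lintegral_inv_colDistSq_le (κ := Fin K) h0 hℓ hℓ0 (by simpa using hlt) k
  have hmap := lintegral_map' (f := fun g => (colDistSq lam k g)⁻¹)
    (measurable_colDistSq lam k).inv.aemeasurable (aemeasurable_columns hlaw)
  rw [map_columns hlaw hindep] at hmap
  rwa [hmap, Fintype.card_fin] at h

/-- A finite negative moment forces every column distance to be nonzero almost surely, so W is
almost surely invertible. -/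
lemma ae_weightedGram_inv_pos
    (hlaw : ∀ m i, HasLaw (fun ω => G ω m i) stdComplexGaussian μ)
    (hindep : iIndepFun (fun (p : Fin M × Fin K) ω => G ω p.1 p.2) μ) {lam : Fin M → ℝ} {ℓ : ℝ}
    (h0 : ∀ m, 0 ≤ lam m) (hℓ : ∀ m, lam m ≤ ℓ) (hℓ0 : 0 < ℓ) (hlt : K * ℓ < ∑ m, lam m)
    (k : Fin K) :
    ∀ᵐ ω ∂μ, 0 < ((weightedGram lam (G ω))⁻¹ k k).re := by
  have h : ∀ i : Fin K, ∀ᵐ ω ∂μ, (colDistSq lam i fun i m => G ω m i)⁻¹ < ⊤ := fun i =>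
    ae_lt_top' ((measurable_colDistSq lam i).inv.comp_aemeasurable (aemeasurable_columns hlaw))
      ((lintegral_inv_colDistSq_comp_le hlaw hindep h0 hℓ hℓ0 hlt i).trans_lt
        ENNReal.ofReal_lt_top).ne
  filter_upwards [ae_all_iff.2 h] with ω hω
  refine (Complex.pos_iff.1 (weightedGram_inv_apply_self_pos h0 (isUnit_det_weightedGram ?_) k)).1
  intro i hi
  have := hω i
  rw [hi, ENNReal.inv_zero] at this
  exact lt_irrefl _ this

lemma integrable_weightedGram_inv
    (hlaw : ∀ m i, HasLaw (fun ω => G ω m i) stdComplexGaussian μ)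
    (hindep : iIndepFun (fun (p : Fin M × Fin K) ω => G ω p.1 p.2) μ) {lam : Fin M → ℝ} {ℓ : ℝ}
    (h0 : ∀ m, 0 ≤ lam m) (hℓ : ∀ m, lam m ≤ ℓ) (hℓ0 : 0 < ℓ) (hlt : K * ℓ < ∑ m, lam m)
    (k : Fin K) :
    Integrable (fun ω => ((weightedGram lam (G ω))⁻¹ k k).re) μ ∧
      ∫ ω, ((weightedGram lam (G ω))⁻¹ k k).re ∂μ ≤ 1 / (∑ m, lam m - K * ℓ) := by
  have hae := (aemeasurable_weightedGram_inv hlaw lam k).aestronglyMeasurable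
  have hnn : 0 ≤ᵐ[μ] fun ω => ((weightedGram lam (G ω))⁻¹ k k).re :=
    ae_of_all _ fun ω => weightedGram_inv_apply_self_re_nonneg h0 k
  have hle : ∫⁻ ω, ENNReal.ofReal ((weightedGram lam (G ω))⁻¹ k k).re ∂μ ≤
      ENNReal.ofReal (1 / (∑ m, lam m - K * ℓ)) :=
    (lintegral_mono fun ω => ofReal_weightedGram_inv_le h0 k).trans
      (lintegral_inv_colDistSq_comp_le hlaw hindep h0 hℓ hℓ0 hlt k)
  refine ⟨⟨hae, ?_⟩, ?_⟩
  · rw [hasFiniteIntegral_iff_ofReal hnn]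
    exact hle.trans_lt ENNReal.ofReal_lt_top
  · rw [integral_eq_lintegral_of_nonneg_ae hnn hae]
    exact ENNReal.toReal_le_of_le_ofReal (one_div_nonneg.2 (by linarith)) hle

omit [IsProbabilityMeasure μ] in
lemma integrable_sum_mul_sq_norm
    (hlaw : ∀ m i, HasLaw (fun ω => G ω m i) stdComplexGaussian μ) (lam : Fin M → ℝ) (k : Fin K) :
    Integrable (fun ω => ∑ m, lam m * ‖G ω m k‖ ^ 2) μ ∧
      ∫ ω, ∑ m, lam m * ‖G ω m k‖ ^ 2 ∂μ = ∑ m, lam m := by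
  have hint : ∀ m, Integrable (fun ω => lam m * ‖G ω m k‖ ^ 2) μ := fun m => by
    refine Integrable.const_mul ?_ _
    have h := integrable_sq_norm_stdComplexGaussian
    rw [← (hlaw m k).map_eq] at h
    exact h.comp_aemeasurable (hlaw m k).aemeasurable
  refine ⟨integrable_finsetSum _ fun m _ => hint m, ?_⟩
  rw [integral_finsetSum _ fun m _ => hint m]
  refine Finset.sum_congr rfl fun m _ => ?_
  have h := integral_map (hlaw m k).aemeasurable (f := fun z : ℂ => ‖z‖ ^ 2) (by fun_prop)
  rw [(hlaw m k).map_eq, integral_sq_norm_stdComplexGaussian] at h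
  rw [integral_const_mul, ← h, mul_one]

lemma log_one_add_mul_inv_nonneg {lam : Fin M → ℝ} (h0 : ∀ m, 0 ≤ lam m) {s : ℝ} (hs : 0 ≤ s)
    (A : Matrix (Fin M) (Fin K) ℂ) (k : Fin K) :
    0 ≤ Real.log (1 + s * (((weightedGram lam A)⁻¹ k k).re)⁻¹) := by
  refine Real.log_nonneg ?_
  have : 0 ≤ s * (((weightedGram lam A)⁻¹ k k).re)⁻¹ :=
    mul_nonneg hs (inv_nonneg.2 (weightedGram_inv_apply_self_re_nonneg h0 k))
  linarith

/-- Tangent line bound for the logarithm, at the mean channel gain `L`. -/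
lemma log_one_add_mul_inv_le {lam : Fin M → ℝ} (h0 : ∀ m, 0 ≤ lam m) {s L : ℝ} (hs : 0 ≤ s)
    (hL : 0 ≤ L) (A : Matrix (Fin M) (Fin K) ℂ) (k : Fin K) :
    Real.log (1 + s * (((weightedGram lam A)⁻¹ k k).re)⁻¹) ≤
      Real.log (1 + s * L) + s / (1 + s * L) * (∑ m, lam m * ‖A m k‖ ^ 2 - L) := by
  have hb := inv_weightedGram_inv_le (G := A) h0 k
  have ha := inv_nonneg.2 (weightedGram_inv_apply_self_re_nonneg (G := A) h0 k)
  set b := (((weightedGram lam A)⁻¹ k k).re)⁻¹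
  set X := ∑ m, lam m * ‖A m k‖ ^ 2
  have h1 : 0 < 1 + s * L := by positivity
  have h2 : 0 < 1 + s * X := by
    have : 0 ≤ s * X := mul_nonneg hs (ha.trans hb)
    linarith
  have h3 : Real.log (1 + s * b) ≤ Real.log (1 + s * X) :=
    Real.log_le_log (by positivity) (by linarith [mul_le_mul_of_nonneg_left hb hs])
  have h4 := Real.log_le_sub_one_of_pos (div_pos h2 h1)
  rw [Real.log_div h2.ne' h1.ne'] at h4
  have h5 : (1 + s * X) / (1 + s * L) - 1 = s / (1 + s * L) * (X - L) := by
    field_simp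
    ring
  linarith

omit [IsProbabilityMeasure μ] in
lemma integrable_log_one_add_mul_inv
    (hlaw : ∀ m i, HasLaw (fun ω => G ω m i) stdComplexGaussian μ) {lam : Fin M → ℝ}
    (h0 : ∀ m, 0 ≤ lam m) {s : ℝ} (hs : 0 ≤ s) (k : Fin K) :
    Integrable (fun ω => Real.log (1 + s * (((weightedGram lam (G ω))⁻¹ k k).re)⁻¹)) μ := by
  have hmeas : AEMeasurable
      (fun ω => Real.log (1 + s * (((weightedGram lam (G ω))⁻¹ k k).re)⁻¹)) μ :=
    Real.measurable_log.comp_aemeasurable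
      (((aemeasurable_weightedGram_inv hlaw lam k).inv.const_mul s).const_add 1)
  refine Integrable.mono' ((integrable_sum_mul_sq_norm hlaw lam k).1.const_mul s)
    hmeas.aestronglyMeasurable (ae_of_all _ fun ω => ?_)
  rw [Real.norm_eq_abs, abs_of_nonneg (log_one_add_mul_inv_nonneg h0 hs _ k)]
  -- The tangent at L = 0 reads log (1 + s / a) ≤ s X, where X = Wₖₖ is integrable.
  have h := log_one_add_mul_inv_le h0 hs le_rfl (G ω) k
  simpa using h

/-- Jensen's inequality in tangent form: taking L = ∑ λ, the mean of Wₖₖ, makes the linear term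
integrate to 0. -/
lemma integral_log_one_add_mul_inv_le
    (hlaw : ∀ m i, HasLaw (fun ω => G ω m i) stdComplexGaussian μ) {lam : Fin M → ℝ}
    (h0 : ∀ m, 0 ≤ lam m) {s : ℝ} (hs : 0 ≤ s) (k : Fin K) :
    ∫ ω, Real.log (1 + s * (((weightedGram lam (G ω))⁻¹ k k).re)⁻¹) ∂μ ≤
      Real.log (1 + s * ∑ m, lam m) := by
  obtain ⟨hint, hval⟩ := integrable_sum_mul_sq_norm hlaw lam k
  have hX : Integrable (fun ω => ∑ m, lam m * ‖G ω m k‖ ^ 2 - ∑ m, lam m) μ :=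
    hint.sub (integrable_const _)
  refine (integral_mono (integrable_log_one_add_mul_inv hlaw h0 hs k)
    ((integrable_const _).add (hX.const_mul _))
    fun ω => log_one_add_mul_inv_le h0 hs (Finset.sum_nonneg fun m _ => h0 m) (G ω) k).trans_eq ?_
  simp only [Pi.add_apply]
  rw [integral_add (integrable_const _) (hX.const_mul _), integral_const_mul,
    integral_sub hint (integrable_const _), hval]
  simp

/-- With L = ∑ λ, the pointwise bound is log (s / a) = log (s L) - log (L a) ≥ log (s L) + 1 - L a;
the moment bound on a then finishes. -/
lemma le_integral_log_one_add_mul_inv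
    (hlaw : ∀ m i, HasLaw (fun ω => G ω m i) stdComplexGaussian μ)
    (hindep : iIndepFun (fun (p : Fin M × Fin K) ω => G ω p.1 p.2) μ) {lam : Fin M → ℝ} {ℓ : ℝ}
    (h0 : ∀ m, 0 ≤ lam m) (hℓ : ∀ m, lam m ≤ ℓ) (hℓ0 : 0 < ℓ) (hlt : K * ℓ < ∑ m, lam m)
    {s : ℝ} (hs : 0 < s) (k : Fin K) :
    Real.log (s * ∑ m, lam m) + (1 - (∑ m, lam m) / (∑ m, lam m - K * ℓ)) ≤
      ∫ ω, Real.log (1 + s * (((weightedGram lam (G ω))⁻¹ k k).re)⁻¹) ∂μ := by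
  obtain ⟨hint, hle⟩ := integrable_weightedGram_inv hlaw hindep h0 hℓ hℓ0 hlt k
  set L := ∑ m, lam m with hLdef
  have hL : 0 < L := lt_of_le_of_lt (by positivity) hlt
  have hi : Integrable (fun ω => 1 - L * ((weightedGram lam (G ω))⁻¹ k k).re) μ :=
    (integrable_const _).sub (hint.const_mul _)
  have hmono := integral_mono_ae ((integrable_const (Real.log (s * L))).add hi)
    (integrable_log_one_add_mul_inv hlaw h0 hs.le k) (by
      filter_upwards [ae_weightedGram_inv_pos hlaw hindep h0 hℓ hℓ0 hlt k] with ω hω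
      set a := ((weightedGram lam (G ω))⁻¹ k k).re
      have h1 : Real.log (s * a⁻¹) ≤ Real.log (1 + s * a⁻¹) :=
        Real.log_le_log (by positivity) (by linarith)
      have h2 := Real.log_le_sub_one_of_pos (mul_pos hL hω)
      have h3 : Real.log (s * a⁻¹) = Real.log (s * L) - Real.log (L * a) := by
        rw [← Real.log_div (by positivity) (by positivity)]
        congr 1
        field_simp
      simp only [Pi.add_apply]
      linarith)
  refine le_trans ?_ hmono
  simp only [Pi.add_apply]
  rw [integral_add (integrable_const _) hi, integral_sub (integrable_const _) (hint.const_mul _),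
    integral_const_mul]
  simp only [integral_const, probReal_univ, one_smul]
  have := mul_le_mul_of_nonneg_left hle hL.le
  rw [mul_one_div] at this
  linarith

end FixedSize

/-! ### Eigenvalues and traces of the correlation matrix. -/

section Spectrum

variable {M : ℕ} {R U : Matrix (Fin M) (Fin M) ℂ} {lam : Fin M → ℝ}

lemma eigenvalues_nonneg_of_posSemidef (hU : U ∈ Matrix.unitaryGroup (Fin M) ℂ)
    (hdec : R = U * Matrix.diagonal (fun m => ((lam m : ℝ) : ℂ)) * Uᴴ) (hR : R.PosSemidef)
    (m : Fin M) : 0 ≤ lam m := by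
  have hUU : Uᴴ * U = 1 := Matrix.mem_unitaryGroup_iff'.1 hU
  have h := hR.conjTranspose_mul_mul_same U
  have hd : Uᴴ * R * U = Matrix.diagonal (fun m => ((lam m : ℝ) : ℂ)) := by
    rw [hdec]
    simp only [Matrix.mul_assoc]
    rw [hUU, Matrix.mul_one, ← Matrix.mul_assoc, hUU, Matrix.one_mul]
  rw [hd] at h
  have := h.diag_nonneg (i := m)
  rw [Matrix.diagonal_apply_eq] at this
  exact Complex.zero_le_real.1 this

lemma trace_eq_sum_eigenvalues (hU : U ∈ Matrix.unitaryGroup (Fin M) ℂ)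
    (hdec : R = U * Matrix.diagonal (fun m => ((lam m : ℝ) : ℂ)) * Uᴴ) :
    R.trace = ((∑ m, lam m : ℝ) : ℂ) := by
  have hUU : Uᴴ * U = 1 := Matrix.mem_unitaryGroup_iff'.1 hU
  rw [hdec, Matrix.trace_mul_comm, ← Matrix.mul_assoc, hUU, Matrix.one_mul, Matrix.trace_diagonal,
    Complex.ofReal_sum]

lemma trace_mul_self_eq_sum_sq_eigenvalues (hU : U ∈ Matrix.unitaryGroup (Fin M) ℂ)
    (hdec : R = U * Matrix.diagonal (fun m => ((lam m : ℝ) : ℂ)) * Uᴴ) :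
    (R * R).trace = ((∑ m, lam m ^ 2 : ℝ) : ℂ) := by
  have hUU : Uᴴ * U = 1 := Matrix.mem_unitaryGroup_iff'.1 hU
  refine trace_eq_sum_eigenvalues (lam := fun m => lam m ^ 2) hU ?_
  have hd : Matrix.diagonal (fun m => ((lam m ^ 2 : ℝ) : ℂ)) =
      Matrix.diagonal (fun m => ((lam m : ℝ) : ℂ)) *
        Matrix.diagonal (fun m => ((lam m : ℝ) : ℂ)) := by
    rw [Matrix.diagonal_mul_diagonal]
    congr 1
    ext m
    push_cast
    ring
  rw [hd, hdec]
  simp only [Matrix.mul_assoc]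
  rw [← Matrix.mul_assoc Uᴴ U, hUU, Matrix.one_mul]

end Spectrum

/-! ### Insensitivity of the logarithm to a fixed shift of M. -/

section Asymptotic

lemma tendsto_log_one_add_sub_mul_sub_log {s : ℝ} (hs : 0 < s) (c : ℝ) :
    Tendsto (fun M : ℕ => Real.log (1 + ((M : ℝ) - c) * s) - Real.log (s * M)) atTop (𝓝 0) := by
  have hlin : Tendsto (fun M : ℕ => s * (M : ℝ)) atTop atTop :=
    tendsto_natCast_atTop_atTop.const_mul_atTop hs
  have h1 : Tendsto (fun M : ℕ => 1 + (1 - c * s) / (s * (M : ℝ))) atTop (𝓝 1) := by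
    simpa using (hlin.const_div_atTop (1 - c * s)).const_add 1
  have h2 := ((Real.continuousAt_log one_ne_zero).tendsto.comp h1)
  rw [Real.log_one] at h2
  refine h2.congr' ?_
  filter_upwards [eventually_gt_atTop 0, hlin.eventually_gt_atTop (c * s)] with M hM hM2
  have hM' : (0 : ℝ) < M := by exact_mod_cast hM
  rw [← Real.log_div (by nlinarith) (by positivity)]
  simp only [Function.comp]
  congr 1
  field_simp
  ring

lemma tendsto_log_one_add_sub_mul_atTop {s : ℝ} (hs : 0 < s) (c : ℝ) :
    Tendsto (fun M : ℕ => Real.log (1 + ((M : ℝ) - c) * s)) atTop atTop := by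
  refine Real.tendsto_log_atTop.comp (tendsto_atTop_add_const_left _ _ ?_)
  exact (tendsto_atTop_add_const_right _ (-c) tendsto_natCast_atTop_atTop).atTop_mul_const hs

end Asymptotic

/-! ### The squeeze as M tends to infinity. -/

theorem theorem4
    {Ω : Type*} [MeasurableSpace Ω] (μ : Measure Ω) [IsProbabilityMeasure μ]
    (K : ℕ) (k : Fin K)
    (P σ ρ : ℝ) (hP : 0 < P) (hσ : 0 < σ) (hρ : 0 < ρ)
    (β : Fin K → ℝ) (hβ : ∀ i, 0 < β i)
    (θ φ w d ϑ : ℝ)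
    -- small-scale fading: for each number `M` of sensors, i.i.d. `CN(0,1)` entries
    (G : ∀ M : ℕ, Ω → Matrix (Fin M) (Fin K) ℂ)
    (hGlaw : ∀ (M : ℕ) (m : Fin M) (i : Fin K),
      HasLaw (fun ω => G M ω m i) stdComplexGaussian μ)
    (hGindep : ∀ M : ℕ, iIndepFun (fun (p : Fin M × Fin K) ω => G M ω p.1 p.2) μ)
    -- receiver-side correlation matrices: Jakes' model, or any trace-normalised model whose
    -- eigenvalues satisfy `∑ λ² = o(M²)`
    (R : ∀ M : ℕ, Matrix (Fin M) (Fin M) ℂ)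
    (hR : (∃ ϖ : ℝ, 0 < ϖ ∧ ∀ M, R M = jakesMatrix ϖ M) ∨
      ((∀ M, (R M).PosSemidef ∧ (R M).trace = (M : ℂ)) ∧
        Tendsto (fun M : ℕ => ((R M * R M).trace).re / (M : ℝ) ^ 2) atTop (𝓝 0)))
    -- eigendecompositions `R = U Λ U*`
    (U : ∀ M : ℕ, Matrix (Fin M) (Fin M) ℂ) (hU : ∀ M, U M ∈ Matrix.unitaryGroup (Fin M) ℂ)
    (lam : ∀ M : ℕ, Fin M → ℝ)
    (hdec : ∀ M, R M = U M * Matrix.diagonal (fun m => ((lam M m : ℝ) : ℂ)) * (U M)ᴴ) :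
    (∀ M : ℕ, Integrable (fun ω => zfRate P σ (responseMatrix ρ θ φ w d ϑ M)
        (cfcChannel (U M) (lam M) β (G M ω)) k) μ) ∧
    ((fun M : ℕ => ∫ ω, zfRate P σ (responseMatrix ρ θ φ w d ϑ M)
        (cfcChannel (U M) (lam M) β (G M ω)) k ∂μ)
      ~[atTop] (fun M : ℕ => Real.logb 2
        (1 + ((M : ℝ) - 2 * (K : ℝ) - 2) * snrOne ρ P σ (β k) * Real.cos φ ^ 2))) ∧
    Tendsto (fun M : ℕ => (∫ ω, zfRate P σ (responseMatrix ρ θ φ w d ϑ M)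
        (cfcChannel (U M) (lam M) β (G M ω)) k ∂μ) -
      Real.logb 2 (1 + ((M : ℝ) - 2 * (K : ℝ) - 2) * snrOne ρ P σ (β k) * Real.cos φ ^ 2))
      atTop (𝓝 0) := by
  have hR' : (∀ M, (R M).PosSemidef ∧ (R M).trace = (M : ℂ)) ∧
      Tendsto (fun M : ℕ => ((R M * R M).trace).re / (M : ℝ) ^ 2) atTop (𝓝 0) := by
    rcases hR with ⟨ϖ, hϖ, hJ⟩ | h
    · simp_rw [hJ]
      exact ⟨fun M => ⟨jakesMatrix_posSemidef ϖ M, jakesMatrix_trace ϖ M⟩,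
        tendsto_jakesMatrix_mul_self_trace hϖ⟩
    · exact h
  obtain ⟨hRM, hRlim⟩ := hR'
  have h0 : ∀ M m, 0 ≤ lam M m := fun M =>
    eigenvalues_nonneg_of_posSemidef (hU M) (hdec M) (hRM M).1
  have hsum : ∀ M, ∑ m, lam M m = M := fun M => by
    apply Complex.ofReal_injective
    rw [← trace_eq_sum_eigenvalues (hU M) (hdec M), (hRM M).2]
    simp
  simp_rw [fun M => trace_mul_self_eq_sum_sq_eigenvalues (hU M) (hdec M), Complex.ofReal_re]
    at hRlim
  have hsnr : 0 < snrOne ρ P σ (β k) := by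
    have := hβ k
    unfold snrOne
    positivity
  simp_rw [fun M ω => zfRate_eq hP hσ hρ hβ θ φ w d ϑ (hU M) (h0 M) (G M ω) k, mul_assoc]
  set s := snrOne ρ P σ (β k) * Real.cos φ ^ 2 with hs_def
  have hs0 : 0 ≤ s := mul_nonneg hsnr.le (sq_nonneg _)
  simp_rw [← mul_assoc (snrOne ρ P σ (β k)), ← hs_def, sub_sub]
  set c : ℝ := 2 * (K : ℝ) + 2
  simp only [Real.logb, integral_div]
  refine ⟨fun M => (integrable_log_one_add_mul_inv (hGlaw M) (h0 M) hs0 k).div_const _, ?_⟩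
  -- Here s = 0 means cos φ = 0, and both rates vanish identically.
  rcases hs0.eq_or_lt with hs | hs
  · simp only [← hs]
    simp only [zero_mul, mul_zero, add_zero, Real.log_one, integral_zero, zero_div, sub_zero]
    exact ⟨IsEquivalent.refl, tendsto_const_nhds⟩
  let I : ℕ → ℝ := fun M =>
    ∫ ω, Real.log (1 + s * (((weightedGram (lam M) (G M ω))⁻¹ k k).re)⁻¹) ∂μ
  -- The Frobenius norm of R dominates every eigenvalue and is o(M) by assumption; the added 1 keeps
  -- ℓ positive, even for M = 0.
  let ℓ : ℕ → ℝ := fun M => √(∑ m, lam M m ^ 2) + 1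
  have hℓ : ∀ M m, lam M m ≤ ℓ M := fun M m => by
    have h1 : lam M m ≤ √(∑ m, lam M m ^ 2) := Real.le_sqrt_of_sq_le
      (Finset.single_le_sum (f := fun m => lam M m ^ 2) (fun i _ => sq_nonneg _)
        (Finset.mem_univ m))
    exact h1.trans (by simp [ℓ])
  have hℓ0 : ∀ M, 0 < ℓ M := fun M => by positivity
  have hℓlim : Tendsto (fun M : ℕ => K * (ℓ M / M)) atTop (𝓝 0) := by
    have h1 := hRlim.sqrt.add (tendsto_one_div_atTop_nhds_zero_nat (𝕜 := ℝ))
    rw [Real.sqrt_zero, add_zero] at h1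
    have h2 := h1.const_mul (K : ℝ)
    rw [mul_zero] at h2
    refine h2.congr fun M => ?_
    rw [Real.sqrt_div (Finset.sum_nonneg fun i _ => sq_nonneg _), Real.sqrt_sq (Nat.cast_nonneg M),
      ← add_div]
  have hlow : ∀ᶠ M : ℕ in atTop,
      Real.log (s * M) + (1 - (1 - K * (ℓ M / M))⁻¹) ≤ I M := by
    filter_upwards [eventually_gt_atTop 0, hℓlim.eventually_lt_const one_pos] with M hM hlt
    have hM' : (0 : ℝ) < M := by exact_mod_cast hM
    rw [← mul_div_assoc, div_lt_one hM'] at hlt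
    have h := le_integral_log_one_add_mul_inv (hGlaw M) (hGindep M) (h0 M) (hℓ M) (hℓ0 M)
      (by rwa [hsum]) hs k
    rw [hsum] at h
    refine le_of_eq_of_le ?_ h
    have : (M : ℝ) - K * ℓ M ≠ 0 := by linarith
    congr 2
    rw [← mul_div_assoc, one_sub_div hM'.ne', inv_div]
  -- The shift 0 is kept visible so that the comparison with log (s M) applies to it as well as to
  -- c.
  have hup : ∀ M : ℕ, I M ≤ Real.log (1 + ((M : ℝ) - 0) * s) := fun M => by
    have h := integral_log_one_add_mul_inv_le (hGlaw M) (h0 M) hs.le k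
    rwa [hsum, mul_comm, ← sub_zero (M : ℝ)] at h
  have hdiff : Tendsto (fun M : ℕ => I M - Real.log (1 + ((M : ℝ) - c) * s)) atTop (𝓝 0) := by
    have hc := tendsto_log_one_add_sub_mul_sub_log hs c
    have hz := tendsto_log_one_add_sub_mul_sub_log hs 0
    have hinv : Tendsto (fun M : ℕ => 1 - (1 - K * (ℓ M / M))⁻¹) atTop (𝓝 0) := by
      have := ((hℓlim.const_sub 1).inv₀ (by norm_num)).const_sub 1
      simpa using this
    have hlo := hinv.sub hc
    have hhi := hz.sub hc
    rw [sub_zero] at hlo hhi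
    refine tendsto_of_tendsto_of_tendsto_of_le_of_le' hlo hhi ?_ ?_
    · filter_upwards [hlow] with M hM
      linarith
    · filter_upwards with M
      linarith [hup M]
  have hlog2 : 0 < Real.log 2 := Real.log_pos one_lt_two
  have hdiff2 : Tendsto (fun M : ℕ => I M / Real.log 2 -
      Real.log (1 + ((M : ℝ) - c) * s) / Real.log 2) atTop (𝓝 0) := by
    simpa [sub_div] using hdiff.div_const (Real.log 2)
  refine ⟨?_, hdiff2⟩
  -- The target diverges, so a vanishing difference is negligible against it; this gives asymptotic
  -- equivalence.
  have hT : Tendsto (fun M : ℕ => Real.log (1 + ((M : ℝ) - c) * s) / Real.log 2) atTop atTop :=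
    (tendsto_log_one_add_sub_mul_atTop hs c).atTop_div_const hlog2
  have h1 : (fun M : ℕ => I M / Real.log 2 - Real.log (1 + ((M : ℝ) - c) * s) / Real.log 2)
      =o[atTop] fun _ => (1 : ℝ) := (isLittleO_one_iff ℝ).2 hdiff2
  exact h1.trans ((isLittleO_const_left_of_ne one_ne_zero).2 (tendsto_norm_atTop_atTop.comp hT))
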